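/- **Theorem (Metastability).** Let $(\Omega,\mathcal F,\mathbb P)$ be a probability space, $\mathcal G\subset\mathcal F$ a sub-$\sigma$-algebra, and let $J=(J_{ij})_{i<j}$ be real random variables that are conditionally independent given $\mathcal G$ and satisfy $|J_{ij}|\le k_J$ a.s. for all $i<j$, with a constant $k_J\in(0,\infty)$. Fix $\beta\in(0,\infty)$ and $h\in\mathbb R$. On $\mathcal S_N=\{-1,1\}^N$ let $$H_N(\sigma)=-\frac1N\sum_{1\le i<j\le N}J_{ij}\sigma_i\sigma_j-h\sum_{i=1}^N\sigma_i,$$ and let $\widetilde H_N$ be the same function with each $J_{ij}$ replaced by $\mathbb E[J_{ij}\mid\mathcal G]$. For a function $H:\mathcal S_N\to\mathbb R$ let $\mu(\sigma)\propto e^{-\beta H(\sigma)}$ be its Gibbs measure, and let $(\Sigma(t))_{t\ge0}$ be the continuous-time Markov chain on $\mathcal S_N$ that jumps from $\sigma$ to $\sigma'$ at rate $e^{-\beta[H(\sigma')-H(\sigma)]_+}$ if $\sigma'$ arises from $\sigma$ by the flip of a single spin, and at rate $0$ otherwise. The chains of $H_N$ and $\widetilde H_N$ are called the quenched and the annealed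 dynamics. For $A\subset\mathcal S_N$ let $\tau_A$ be the first return time to $A$: the first time at which $\Sigma(t)\in A$ after the chain has left its initial state. Let $K\ge2$. For $\rho>0$ the chain of $H$ is called *$\rho$-metastable* with respect to pairwise disjoint non-empty sets $M_1,\dots,M_K\subset\mathcal S_N$ with union $M\neq\mathcal S_N$ if $$K\,\frac{\max_{1\le j\le K}\mathbf P_{\mu|M_j}\bigl[\tau_{M\setminus M_j}<\tau_{M_j}\bigr]}{\min_{\emptyset\ne X\subset\mathcal S_N\setminus M}\mathbf P_{\mu|X}\bigl[\tau_M<\tau_X\bigr]}\le\rho,$$ where $\mathbf P_\nu$ is the law of the chain with initial distribution $\nu$ and $\mu|X$ is $\mu$ conditioned on $X$. Let $k_1>0$, and for $N\in\mathbb N$ and $\omega\in\Omega$ let $M_{1,N}(\omega),\dots,M_{K,N}(\omega)$ be subsets of $\mathcal S_N$ such that, $\mathbb P$-almost surely, for all sufficiently large $N$ (depending on $\omega$), the annealed dynamics is $e^{-k_1N}$-metastable with respect to $M_{1,N}(\omega),\dots,M_{K,N}(\omega)$. Then for every $c_0\in(0,k_1)$, $\mathbb P$-almost surely, for all sufficiently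 large $N$, the annealed dynamics is $e^{-k_1N}$-metastable and the quenched dynamics is $e^{-c_0N}$-metastable with respect to the same sets $M_{1,N}(\omega),\dots,M_{K,N}(\omega)$. -/

import Mathlib

open MeasureTheory ProbabilityTheory Filter
open scoped NNReal ENNReal

noncomputable section

namespace GlauberMeta

/-! ### Continuous-time Markov chains on a finite state space -/

section Chain

variable {V : Type*} [Fintype V]

/-- Total jump rate out of `x`, for jump rates `r` that vanish on the diagonal. -/
def exitRate (r : V → V → ℝ≥0) (x : V) : ℝ≥0 := ∑ y, r x y

variable [MeasurableSpace V]

open Classical in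
/-- Law of the next state of the chain with jump rates `r` when it leaves `x`: the state `y` is
chosen with probability `r x y / exitRate r x`. An absorbing state is never left. -/
def jumpMeasure (r : V → V → ℝ≥0) (x : V) : Measure V :=
  if exitRate r x = 0 then Measure.dirac x
  else ∑ y, ((r x y / exitRate r x : ℝ≥0) : ℝ≥0∞) • Measure.dirac y

instance (r : V → V → ℝ≥0) (x : V) : IsProbabilityMeasure (jumpMeasure r x) := by
  unfold jumpMeasure
  split_ifs with h
  · infer_instance
  · constructor
    simp only [Measure.coe_finsetSum, Finset.sum_apply, Measure.smul_apply, measure_univ,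
      smul_eq_mul, mul_one]
    rw [← ENNReal.ofNNReal_finsetSum, ← Finset.sum_div]
    have : (∑ y, r x y) / exitRate r x = 1 := div_self h
    rw [this, ENNReal.coe_one]

variable [MeasurableSingletonClass V]

/-- The jump probabilities as a Markov kernel. -/
def jumpKernel (r : V → V → ℝ≥0) : Kernel V V := Kernel.ofFunOfCountable (jumpMeasure r)

instance (r : V → V → ℝ≥0) : IsMarkovKernel (jumpKernel r) :=
  ⟨fun x => inferInstanceAs (IsProbabilityMeasure (jumpMeasure r x))⟩

/-- The `n`-th transition of the jump chain, as a kernel depending on the whole past through the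
present state only. -/
def stepKernel (r : V → V → ℝ≥0) (n : ℕ) :
    Kernel ((i : Finset.Iic n) → (fun _ : ℕ => V) i) V :=
  (jumpKernel r).comap (fun p => p ⟨n, Finset.mem_Iic.2 le_rfl⟩) (measurable_pi_apply _)

instance (r : V → V → ℝ≥0) (n : ℕ) : IsMarkovKernel (stepKernel r n) := by
  unfold stepKernel; infer_instance

/-- Law of the jump chain `(Y₀, Y₁, Y₂, …)` started in `x`. -/
def jumpChainLaw (r : V → V → ℝ≥0) (x : V) : Measure (ℕ → V) :=
  Kernel.traj (X := fun _ => V) (stepKernel r) 0 (fun _ => x)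

/-- Joint law of the jump chain started in `x` and an independent sequence `ξ₀, ξ₁, …` of
independent exponential variables with mean `1`. -/
def driverLaw (r : V → V → ℝ≥0) (x : V) : Measure ((ℕ → V) × (ℕ → ℝ)) :=
  (jumpChainLaw r x).prod (Measure.infinitePi fun _ : ℕ => expMeasure 1)

/-- Time of the `n`-th jump: the chain stays in its `k`-th state `Y k` during a time
`ξ k / exitRate r (Y k)` (forever if the state is absorbing). -/
def jumpTime (r : V → V → ℝ≥0) (p : (ℕ → V) × (ℕ → ℝ)) (n : ℕ) : ℝ≥0∞ :=
  ∑ k ∈ Finset.range n, ENNReal.ofReal (p.2 k) / (exitRate r (p.1 k) : ℝ≥0∞)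

/-- The continuous-time Markov chain with jump rates `r`: its state at time `t` is `Y n` where `n`
is the number of jumps up to time `t` (a finite number, almost surely). -/
def chainPath (r : V → V → ℝ≥0) (p : (ℕ → V) × (ℕ → ℝ)) (t : ℝ≥0) : V :=
  p.1 (sSup {n : ℕ | jumpTime r p n ≤ (t : ℝ≥0∞)})

/-- First return time of a path to `A`: the first time at which the path is in `A` after it has
left its initial state (`⊤` if there is no such time). -/
def returnTime (γ : ℝ≥0 → V) (A : Set V) : ℝ≥0∞ :=
  ⨅ t ∈ {t : ℝ≥0 | 0 < t ∧ γ t ∈ A ∧ ∃ s ≤ t, γ s ≠ γ 0}, (t : ℝ≥0∞)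

/-- Probability that the chain with jump rates `r` and initial distribution `ν` returns to `B`
before it returns to `A`. -/
def returnBeforeProb (r : V → V → ℝ≥0) (ν : Measure V) (B A : Set V) : ℝ≥0∞ :=
  ∫⁻ x, driverLaw r x {p | returnTime (chainPath r p) B < returnTime (chainPath r p) A} ∂ν

/-- The chain with jump rates `r` and reversible measure `μ` is `ρ`-metastable with respect to the
pairwise disjoint non-empty sets `M j`. The infimum is over the non-empty subsets `X` of the
complement of the union of the `M j`, which is required to be non-empty. -/
def IsMetastable (r : V → V → ℝ≥0) (μ : Measure V) (ρ : ℝ) {K : ℕ} (M : Fin K → Set V) : Prop :=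
  (∀ j, (M j).Nonempty) ∧
  (∀ i j, i ≠ j → Disjoint (M i) (M j)) ∧
  (⋃ j, M j)ᶜ.Nonempty ∧
  (K : ℝ≥0∞) *
      (⨆ j, returnBeforeProb r (μ[|M j]) ((⋃ i, M i) \ M j) (M j)) /
      (⨅ X ∈ {X : Set V | X.Nonempty ∧ X ⊆ (⋃ i, M i)ᶜ},
        returnBeforeProb r (μ[|X]) (⋃ i, M i) X)
    ≤ ENNReal.ofReal ρ

end Chain

/-! ### The spin model -/

/-- Spin configurations: `{-1, 1}^N`. -/
abbrev Config (N : ℕ) : Type := Fin N → ℤˣ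

instance : MeasurableSingletonClass ℤˣ where
  measurableSet_singleton u := by
    refine ⟨{(u : ℤ)}, measurableSet_singleton _, ?_⟩
    ext v
    simp [Units.ext_iff]

/-- The spin at site `i` as a real number. -/
def spin {N : ℕ} (σ : Config N) (i : Fin N) : ℝ := ((σ i : ℤ) : ℝ)

/-- The Hamiltonian with couplings `J i j`, `i < j`, and magnetic field `h`. -/
def hamiltonian (h : ℝ) (J : ℕ → ℕ → ℝ) (N : ℕ) (σ : Config N) : ℝ :=
  -(1 / (N : ℝ)) * (∑ i : Fin N, ∑ j : Fin N, if i < j then J i j * spin σ i * spin σ j else 0)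
    - h * ∑ i : Fin N, spin σ i

/-- The partition function. -/
def partitionFunction (β : ℝ) {N : ℕ} (H : Config N → ℝ) : ℝ := ∑ σ, Real.exp (-β * H σ)

/-- The Gibbs measure. -/
def gibbsMeasure (β : ℝ) {N : ℕ} (H : Config N → ℝ) : Measure (Config N) :=
  ∑ σ, ENNReal.ofReal (Real.exp (-β * H σ) / partitionFunction β H) • Measure.dirac σ

/-- `σ'` is obtained from `σ` by the flip of a single spin. -/
def SingleFlip {N : ℕ} (σ σ' : Config N) : Prop := ∃ i, σ' = Function.update σ i (-σ i)

open Classical in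
/-- Glauber-Metropolis transition rates. -/
def glauberRate (β : ℝ) {N : ℕ} (H : Config N → ℝ) (σ σ' : Config N) : ℝ≥0 :=
  if SingleFlip σ σ' then Real.toNNReal (Real.exp (-β * max (H σ' - H σ) 0)) else 0

/-- The Glauber-Metropolis dynamics for the Hamiltonian `H` at inverse temperature `β` is
`ρ`-metastable with respect to the sets `M j`. -/
def GlauberMetastable (β : ℝ) {N : ℕ} (H : Config N → ℝ) (ρ : ℝ) {K : ℕ}
    (M : Fin K → Set (Config N)) : Prop :=
  IsMetastable (glauberRate β H) (gibbsMeasure β H) ρ M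

/-! ### Random couplings -/

section Random

variable {Ω : Type*}

/-- Conditional independence, given the sub-σ-algebra `𝒢`, of a family of real random variables on
an arbitrary probability space. -/
def CondIndepFamily (𝒢 : MeasurableSpace Ω) {mΩ : MeasurableSpace Ω} (P : Measure Ω) {ι : Type*}
    (X : ι → Ω → ℝ) : Prop :=
  ∀ (s : Finset ι) (B : ι → Set ℝ), (∀ i ∈ s, MeasurableSet (B i)) →
    P⟦⋂ i ∈ s, X i ⁻¹' B i | 𝒢⟧ =ᵐ[P] ∏ i ∈ s, P⟦X i ⁻¹' B i | 𝒢⟧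

/-- The quenched Hamiltonian. -/
def quenchedHamiltonian (h : ℝ) (J : ℕ → ℕ → Ω → ℝ) (N : ℕ) (ω : Ω) : Config N → ℝ :=
  hamiltonian h (fun i j => J i j ω) N

/-- The annealed Hamiltonian: every coupling is replaced by its conditional mean given `𝒢`. -/
def annealedHamiltonian (𝒢 : MeasurableSpace Ω) {mΩ : MeasurableSpace Ω} (P : Measure Ω) (h : ℝ)
    (J : ℕ → ℕ → Ω → ℝ) (N : ℕ) (ω : Ω) : Config N → ℝ :=
  hamiltonian h (fun i j => (P[J i j | 𝒢]) ω) N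

end Random

end GlauberMeta

end

/-!
Metastability is a ratio of escape probabilities, and these are robust under small changes of the
Hamiltonian. The theorem combines a deterministic comparison with a concentration estimate.

*Comparison.* Started in `A`, whether the continuous-time chain returns to `B` before `A` is almost
surely a property of the jump chain alone (`returnTime_lt_iff`). By the Markov property of the jump
chain at time one (`jumpChainLaw_eq_sum`) the probability of hitting `B` before `A` is harmonic off
`A ∪ B`, so the sum over `A` of the escape probabilities, weighted by the reversible measure times
the exit rate, is the Dirichlet energy of this potential (`sum_escape_eq_dirichletForm`). The
Dirichlet principle (`dirichletForm_le_of_harmonic`) makes this energy monotone in the conductances.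
For the Glauber-Metropolis dynamics the conductance of a flip `σ → σ'` is
`exp (-β * max (H σ) (H σ'))` up to normalization. If two Hamiltonians differ by at most `δ`, then
weights and conductances agree up to a factor `exp (2 * β * δ)`. The exit rates lie between
`exp (-β * D)` and `N`, where `D` bounds the energy change of a single flip, uniformly in `N`. All
escape probabilities hence agree up to `N * exp (4 * β * δ + β * D)`, and the ratio that defines
metastability up to the square of that (`GlauberMetastable.of_abs_sub_le`).

*Concentration.* For fixed `σ`, the difference of the quenched and the annealed Hamiltonian is
`1 / N` times a sum of at most `N ^ 2` conditionally independent, centred, bounded variables.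
Bounding each exponential by a chord reduces a Chernoff bound to the averages of products of affine
functions of these variables (`integral_prod_one_add`), which equal one by conditional
independence. The difference exceeds `ε * N` with probability at most `exp (-g * N ^ 2)`, which
beats the number `2 ^ N` of configurations, and Borel-Cantelli applies
(`ae_eventually_abs_quenched_sub_annealed_le`). With `ε` small compared to `k₁ - c₀` the loss in the
comparison is at most `exp ((k₁ - c₀) * N)`.
-/

noncomputable section

namespace GlauberMeta

/-! ### The Markov property of the jump chain -/

section JumpChain

/-- A finite measure on sequences in a countable space is determined by the probabilities of the
events that fix an initial segment. -/
theorem measure_seq_ext {V : Type*} [Countable V] [MeasurableSpace V] [MeasurableSingletonClass V]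
    {μ ν : Measure (ℕ → V)} [IsFiniteMeasure μ]
    (h : ∀ (n : ℕ) (v : ℕ → V), μ {Y | ∀ i ≤ n, Y i = v i} = ν {Y | ∀ i ≤ n, Y i = v i}) :
    μ = ν := by
  have hfam : IsProjectiveMeasureFamily (α := fun _ : ℕ => V)
      (fun I : Finset ℕ => μ.map (I.restrict (π := fun _ => V))) := by
    intro I J hJI
    rw [Measure.map_map (by fun_prop) (by fun_prop)]
    rfl
  have hμ : IsProjectiveLimit (α := fun _ : ℕ => V) μ
      (fun I : Finset ℕ => μ.map (I.restrict (π := fun _ => V))) :=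
    fun I => rfl
  refine IsProjectiveLimit.unique hμ ((isProjectiveLimit_nat_iff hfam ν).2 fun n => ?_)
  refine Measure.ext_of_singleton fun z => ?_
  have key : ∀ ρ : Measure (ℕ → V), ρ.map (Preorder.frestrictLe (π := fun _ => V) n) {z}
      = ρ {Y | ∀ i ≤ n, Y i = if hi : i ≤ n then z ⟨i, Finset.mem_Iic.2 hi⟩ else Y 0} := by
    intro ρ
    rw [Measure.map_apply (by fun_prop) (measurableSet_singleton _)]
    congr 1
    ext Y
    simp only [Set.mem_preimage, Set.mem_singleton_iff, Set.mem_ofPred_eq, funext_iff]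
    constructor
    · intro hY i hi
      simpa [hi] using hY ⟨i, Finset.mem_Iic.2 hi⟩
    · rintro hY ⟨i, hi⟩
      have := hY i (Finset.mem_Iic.1 hi)
      simpa [Finset.mem_Iic.1 hi] using this
  have hv : ∀ ρ : Measure (ℕ → V), ρ.map (Preorder.frestrictLe (π := fun _ => V) n) {z}
      = ρ {Y | ∀ i ≤ n, Y i = z ⟨min i n, Finset.mem_Iic.2 (min_le_right _ _)⟩} := by
    intro ρ
    rw [key]
    congr 1
    ext Y
    simp only [Set.mem_ofPred_eq]
    refine forall₂_congr fun i hi => ?_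
    simp [hi]
  rw [hv]
  change _ = μ.map (Preorder.frestrictLe (π := fun _ => V) n) {z}
  rw [hv μ, h]

variable {V : Type*} [Fintype V] [MeasurableSpace V] [MeasurableSingletonClass V]

instance (r : V → V → ℝ≥0) (x : V) : IsProbabilityMeasure (jumpChainLaw r x) := by
  unfold jumpChainLaw; infer_instance

theorem measurableSet_initialSegment {V : Type*} [MeasurableSpace V] [MeasurableSingletonClass V]
    (n : ℕ) (v : ℕ → V) :
    MeasurableSet {Y : ℕ → V | ∀ i ≤ n, Y i = v i} := by
  have : {Y : ℕ → V | ∀ i ≤ n, Y i = v i} = ⋂ i ∈ Set.Iic n, (fun Y => Y i) ⁻¹' {v i} := by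
    ext; simp
  rw [this]
  exact MeasurableSet.biInter (Set.to_countable _)
    fun i _ => measurable_pi_apply i (measurableSet_singleton _)

open Classical in
theorem jumpChainLaw_initialSegment (r : V → V → ℝ≥0) (x : V) (v : ℕ → V) (n : ℕ) :
    jumpChainLaw r x {Y | ∀ i ≤ n, Y i = v i}
      = if v 0 = x then ∏ i ∈ Finset.range n, jumpMeasure r (v i) {v (i + 1)} else 0 := by
  induction n with
  | zero =>
    have h0 := Kernel.traj_map_frestrictLe_apply (X := fun _ => V) (κ := stepKernel r) 0 0
      (fun _ => x)
    rw [Kernel.partialTraj_self, Kernel.id_apply] at h0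
    have hs : {Y : ℕ → V | ∀ i ≤ 0, Y i = v i}
        = Preorder.frestrictLe (π := fun _ => V) 0 ⁻¹' {fun _ => v 0} := by
      ext Y
      simp only [Set.mem_ofPred_eq, Set.mem_preimage, Set.mem_singleton_iff, funext_iff]
      constructor
      · rintro h ⟨i, hi⟩
        obtain rfl : i = 0 := by simpa using hi
        exact h 0 le_rfl
      · intro h i hi
        obtain rfl : i = 0 := by omega
        exact h ⟨0, by simp⟩
    rw [jumpChainLaw, hs, ← Measure.map_apply (by fun_prop) (measurableSet_singleton _), h0,
      Measure.dirac_apply' _ (measurableSet_singleton _)]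
    by_cases hx : v 0 = x
    · simp [hx]
    · have : (fun _ => x : (i : Finset.Iic 0) → V) ∉ ({fun _ => v 0} : Set _) := by
        intro h
        exact hx (congrFun h ⟨0, by simp⟩).symm
      simp [hx, this]
  | succ n ih =>
    have h1 := Kernel.partialTraj_compProd_eq_map_traj (X := fun _ => V) (κ := stepKernel r)
      (Nat.zero_le n) (x₀ := fun _ => x)
    set z : (i : Finset.Iic n) → V := fun i => v i with hz
    have hn : {Y : ℕ → V | ∀ i ≤ n, Y i = v i}
        = Preorder.frestrictLe (π := fun _ => V) n ⁻¹' {z} := by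
      ext Y
      simp only [Set.mem_ofPred_eq, Set.mem_preimage, Set.mem_singleton_iff, funext_iff, hz]
      exact ⟨fun h i => h i (Finset.mem_Iic.1 i.2), fun h i hi => h ⟨i, Finset.mem_Iic.2 hi⟩⟩
    have hs : {Y : ℕ → V | ∀ i ≤ n + 1, Y i = v i}
        = (fun Y : ℕ → V => (Preorder.frestrictLe (π := fun _ => V) n Y, Y (n + 1))) ⁻¹'
          ({z} ×ˢ {v (n + 1)}) := by
      rw [Set.mk_preimage_prod, ← hn]
      ext Y
      simp only [Set.mem_ofPred_eq, Set.mem_inter_iff, Set.mem_preimage, Set.mem_singleton_iff]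
      exact ⟨fun h => ⟨fun i hi => h i (by omega), h _ le_rfl⟩, fun h i hi => by
        rcases Nat.lt_or_eq_of_le hi with h' | rfl
        · exact h.1 i (by omega)
        · exact h.2⟩
    rw [jumpChainLaw, hs, ← Measure.map_apply (by fun_prop)
      ((measurableSet_singleton _).prod (measurableSet_singleton _)), ← h1,
      Measure.compProd_apply_prod (measurableSet_singleton _) (measurableSet_singleton _),
      lintegral_singleton, ← Kernel.traj_map_frestrictLe_apply,
      Measure.map_apply (by fun_prop) (measurableSet_singleton _), ← hn]
    change _ * jumpChainLaw r x _ = _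
    rw [ih, Finset.prod_range_succ]
    have : stepKernel r n z = jumpMeasure r (v n) := rfl
    rw [this]
    split_ifs
    · rw [mul_comm]
    · simp

/-- The sequence that starts with `x` and continues with `Y`. -/
def consPath {V : Type*} (x : V) (Y : ℕ → V) : ℕ → V := fun n => Nat.casesOn n x Y

theorem measurable_consPath {V : Type*} [MeasurableSpace V] (x : V) : Measurable (consPath x) := by
  refine measurable_pi_lambda _ fun n => ?_
  cases n with
  | zero => exact measurable_const
  | succ n => exact measurable_pi_apply n

/-- The Markov property of the jump chain at time one. -/
theorem jumpChainLaw_eq_sum (r : V → V → ℝ≥0) (x : V) :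
    jumpChainLaw r x
      = ∑ y, jumpMeasure r x {y} • (jumpChainLaw r y).map (consPath x) := by
  classical
  refine measure_seq_ext fun n v => ?_
  rw [jumpChainLaw_initialSegment]
  simp only [Measure.coe_finsetSum, Finset.sum_apply, Measure.smul_apply, smul_eq_mul,
    Measure.map_apply (measurable_consPath x) (measurableSet_initialSegment n v)]
  have hpre : consPath x ⁻¹' {Y | ∀ i ≤ n, Y i = v i}
      = if v 0 = x then {Y | ∀ i < n, Y i = v (i + 1)} else ∅ := by
    ext Y
    split_ifs with h
    · simp only [Set.mem_preimage, Set.mem_ofPred_eq]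
      constructor
      · exact fun H i hi => H (i + 1) (by omega)
      · intro H i hi
        cases i with
        | zero => exact h.symm
        | succ i => exact H i (by omega)
    · simp only [Set.mem_preimage, Set.mem_ofPred_eq, Set.mem_empty_iff_false, iff_false]
      exact fun H => h (H 0 (Nat.zero_le _)).symm
  rw [hpre]
  split_ifs with h
  · cases n with
    | zero =>
      have : {Y : ℕ → V | ∀ i < 0, Y i = v (i + 1)} = Set.univ := by ext; simp
      rw [this]
      simp only [measure_univ, mul_one, Finset.range_zero, Finset.prod_empty]
      have := measure_univ (μ := jumpMeasure r x)
      rw [← this, ← Finset.coe_univ, ← sum_measure_singleton]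
    | succ n =>
      have : {Y : ℕ → V | ∀ i < n + 1, Y i = v (i + 1)}
          = {Y | ∀ i ≤ n, Y i = (fun k => v (k + 1)) i} := by
        ext Y; simp
      rw [this]
      simp only [jumpChainLaw_initialSegment]
      rw [Finset.prod_range_succ']
      simp [h, mul_comm]
  · simp

end JumpChain

/-! ### Return times and hitting probabilities -/

section ReturnTimes

/-- The trajectories that visit `B` at some positive time, before or without visiting `A` at a
positive time. -/
def hitEvent {V : Type*} (B A : Set V) : Set (ℕ → V) :=
  {Y | ∃ n, 1 ≤ n ∧ Y n ∈ B ∧ ∀ k, 1 ≤ k → k ≤ n → Y k ∉ A}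

variable {V : Type*} [Fintype V] {r : V → V → ℝ≥0} {p : (ℕ → V) × (ℕ → ℝ)}

theorem jumpTime_ne_top (hr : ∀ x, exitRate r x ≠ 0) (n : ℕ) : jumpTime r p n ≠ ∞ := by
  refine ENNReal.sum_ne_top.2 fun k _ => ENNReal.div_ne_top ENNReal.ofReal_ne_top ?_
  simpa using hr _

theorem jumpTime_strictMono (hr : ∀ x, exitRate r x ≠ 0) (hξ : ∀ k, 0 < p.2 k) :
    StrictMono (jumpTime r p) := by
  refine strictMono_nat_of_lt_succ fun n => ?_
  rw [jumpTime, jumpTime, Finset.sum_range_succ]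
  refine ENNReal.lt_add_right (jumpTime_ne_top (p := p) hr n) ?_
  exact (ENNReal.div_pos (by simpa using hξ n) ENNReal.coe_ne_top).ne'

theorem chainPath_eq_of_mem (hmono : StrictMono (jumpTime r p)) {t : ℝ≥0} {n : ℕ}
    (h1 : jumpTime r p n ≤ t) (h2 : (t : ℝ≥0∞) < jumpTime r p (n + 1)) :
    chainPath r p t = p.1 n := by
  have : {m : ℕ | jumpTime r p m ≤ (t : ℝ≥0∞)} = Set.Iic n := by
    ext m
    simp only [Set.mem_ofPred_eq, Set.mem_Iic]
    constructor
    · intro h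
      exact Nat.lt_succ_iff.1 (hmono.lt_iff_lt.1 (h.trans_lt h2))
    · intro h
      exact (hmono.monotone h).trans h1
  rw [chainPath, this, csSup_Iic]

/-- At a time beyond a possible explosion, the path shows the initial state, because the supremum
of an unbounded set of natural numbers is `0`. -/
theorem chainPath_cases (hmono : StrictMono (jumpTime r p)) (t : ℝ≥0) :
    (∃ n, jumpTime r p n ≤ t ∧ (t : ℝ≥0∞) < jumpTime r p (n + 1) ∧ chainPath r p t = p.1 n) ∨
      ((∀ n, jumpTime r p n ≤ t) ∧ chainPath r p t = p.1 0) := by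
  by_cases h : ∀ n, jumpTime r p n ≤ t
  · refine Or.inr ⟨h, ?_⟩
    have : {m : ℕ | jumpTime r p m ≤ (t : ℝ≥0∞)} = Set.univ := Set.eq_univ_of_forall h
    rw [chainPath, this, Nat.sSup_of_not_bddAbove not_bddAbove_univ]
  · left
    classical
    have h' : ∃ n, (t : ℝ≥0∞) < jumpTime r p n := by push Not at h; exact h
    have h0 : Nat.find h' ≠ 0 := by
      intro h0
      have := Nat.find_spec h'
      rw [h0] at this
      simp [jumpTime] at this
    obtain ⟨n, hn⟩ := Nat.exists_eq_succ_of_ne_zero h0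
    have h2 : (t : ℝ≥0∞) < jumpTime r p (n + 1) := by
      have := Nat.find_spec h'
      rwa [hn] at this
    have h1 : jumpTime r p n ≤ t := not_lt.1 (Nat.find_min h' (by omega))
    exact ⟨n, h1, h2, chainPath_eq_of_mem hmono h1 h2⟩

/-- For a chain that starts in `A` and has positive holding times, returning to `B` before `A` is a
property of the jump chain. No assumption against explosion is needed: after an explosion the path
sits in the initial state, which lies in `A`. -/
theorem returnTime_lt_iff (hr : ∀ x, exitRate r x ≠ 0) (hξ : ∀ k, 0 < p.2 k) {A B : Set V}
    (hAB : Disjoint A B) (h0 : p.1 0 ∈ A) (h1 : p.1 1 ≠ p.1 0) :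
    returnTime (chainPath r p) B < returnTime (chainPath r p) A ↔ p.1 ∈ hitEvent B A := by
  have hmono : StrictMono (jumpTime r p) := jumpTime_strictMono hr hξ
  have hfin := jumpTime_ne_top (r := r) (p := p) hr
  have hT0 : jumpTime r p 0 = 0 := by simp [jumpTime]
  have hjump : ∀ n, chainPath r p (jumpTime r p n).toNNReal = p.1 n := fun n => by
    apply chainPath_eq_of_mem hmono
    · rw [ENNReal.coe_toNNReal (hfin n)]
    · rw [ENNReal.coe_toNNReal (hfin n)]; exact hmono (Nat.lt_succ_self n)
  have hinit : chainPath r p 0 = p.1 0 := by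
    simpa [hT0] using hjump 0
  -- A visit at the positive time `n` of the jump chain is seen by the continuous-time path.
  have hle : ∀ (C : Set V) n, 1 ≤ n → p.1 n ∈ C →
      returnTime (chainPath r p) C ≤ jumpTime r p n := by
    intro C n hn hC
    have hpos : 0 < jumpTime r p n := by rw [← hT0]; exact hmono (by omega)
    rw [← ENNReal.coe_toNNReal (hfin n)]
    refine iInf₂_le (jumpTime r p n).toNNReal ⟨?_, by rwa [hjump], ?_⟩
    · exact ENNReal.toNNReal_pos hpos.ne' (hfin n)
    · refine ⟨(jumpTime r p 1).toNNReal,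
        ENNReal.toNNReal_mono (hfin n) (hmono.monotone hn), ?_⟩
      rwa [hjump, hinit]
  constructor
  · intro h
    rw [returnTime] at h
    obtain ⟨t, ht⟩ := iInf_lt_iff.1 h
    obtain ⟨⟨-, htB, -⟩, htA⟩ := iInf_lt_iff.1 ht
    obtain ⟨n, hn1, hn2, hn⟩ | ⟨-, hn⟩ := chainPath_cases hmono t
    · rw [hn] at htB
      refine ⟨n, ?_, htB, fun k hk hkn hkA => ?_⟩
      · by_contra hn0
        obtain rfl : n = 0 := by omega
        exact Set.disjoint_left.1 hAB h0 htB
      · exact absurd ((hle A k hk hkA).trans ((hmono.monotone hkn).trans hn1)) (not_le.2 htA)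
    · rw [hn] at htB
      exact absurd htB (Set.disjoint_left.1 hAB h0)
  · rintro ⟨n, hn1, hnB, hnA⟩
    refine (hle B n hn1 hnB).trans_lt ((hmono (Nat.lt_succ_self n)).trans_le ?_)
    refine le_iInf₂ fun t ht => ?_
    obtain ⟨-, htA, s, hst, hs⟩ := ht
    by_contra hlt
    rw [not_le] at hlt
    obtain ⟨m, hm1, hm2, hm⟩ | ⟨hall, -⟩ := chainPath_cases hmono t
    · have hmn : m ≤ n := Nat.lt_succ_iff.1 (hmono.lt_iff_lt.1 (hm1.trans_lt hlt))
      rcases Nat.eq_zero_or_pos m with rfl | hm0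
      · refine hs ?_
        rw [hinit]
        refine chainPath_eq_of_mem hmono (by rw [hT0]; exact zero_le) (lt_of_le_of_lt ?_ hm2)
        exact_mod_cast hst
      · rw [hm] at htA
        exact hnA m hm0 hmn htA
    · exact absurd (hall (n + 1)) (not_le.2 hlt)

end ReturnTimes

section HittingProbabilities

theorem expMeasure_one_ae_pos : ∀ᵐ x ∂(expMeasure 1), 0 < x := by
  have h := cdf_expMeasure_eq (r := 1) one_pos 0
  have := isProbabilityMeasure_expMeasure (r := 1) one_pos
  rw [cdf_eq_real] at h
  have h0 : (expMeasure 1) (Set.Iic 0) = 0 := by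
    rw [← measureReal_eq_zero_iff, h]; simp
  rw [ae_iff]
  simpa [Set.Iic] using h0

theorem holdingTimes_ae_pos :
    ∀ᵐ ξ ∂(Measure.infinitePi fun _ : ℕ => expMeasure 1), ∀ k, 0 < ξ k := by
  have := isProbabilityMeasure_expMeasure (r := 1) one_pos
  rw [ae_all_iff]
  intro k
  exact (measurePreserving_eval_infinitePi (fun _ : ℕ => expMeasure 1) k).quasiMeasurePreserving.ae
    expMeasure_one_ae_pos

variable {V : Type*} [Fintype V] [MeasurableSpace V] [MeasurableSingletonClass V]
  {r : V → V → ℝ≥0}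

theorem measurableSet_hitEvent (B A : Set V) : MeasurableSet (hitEvent B A) := by
  have : hitEvent B A = ⋃ n ∈ {n : ℕ | 1 ≤ n}, ((fun Y : ℕ → V => Y n) ⁻¹' B ∩
      ⋂ k ∈ {k : ℕ | 1 ≤ k ∧ k ≤ n}, (fun Y : ℕ → V => Y k) ⁻¹' Aᶜ) := by
    ext Y; simp [hitEvent, and_left_comm]
  rw [this]
  refine MeasurableSet.biUnion (Set.to_countable _) fun n _ => MeasurableSet.inter ?_ ?_
  · exact measurable_pi_apply n (Set.toFinite B).measurableSet
  · exact MeasurableSet.biInter (Set.to_countable _)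
      fun k _ => measurable_pi_apply k (Set.toFinite _).measurableSet

theorem jumpChainLaw_ae_zero (r : V → V → ℝ≥0) (x : V) : ∀ᵐ Y ∂(jumpChainLaw r x), Y 0 = x := by
  have h := jumpChainLaw_initialSegment r x (fun _ => x) 0
  have hs : {Y : ℕ → V | ∀ i ≤ 0, Y i = (fun _ => x) i} = {Y | Y 0 = x} := by ext; simp
  rw [hs] at h
  have hm : MeasurableSet {Y : ℕ → V | Y 0 = x} :=
    measurableSet_eq_fun (measurable_pi_apply 0) measurable_const
  exact (prob_compl_eq_zero_iff hm).2 (by simpa using h)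

theorem jumpMeasure_singleton (hr : ∀ x, exitRate r x ≠ 0) (x y : V) :
    jumpMeasure r x {y} = ((r x y / exitRate r x : ℝ≥0) : ℝ≥0∞) := by
  classical
  rw [jumpMeasure, if_neg (hr x)]
  simp only [Measure.coe_finsetSum, Finset.sum_apply, Measure.smul_apply, smul_eq_mul,
    Measure.dirac_apply' _ (measurableSet_singleton y), Set.indicator_apply,
    Set.mem_singleton_iff, Pi.one_apply, mul_ite, mul_one, mul_zero]
  simp

theorem jumpChainLaw_ae_one_ne (hr : ∀ x, exitRate r x ≠ 0) (hdiag : ∀ x, r x x = 0) (x : V) :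
    ∀ᵐ Y ∂(jumpChainLaw r x), Y 1 ≠ Y 0 := by
  rw [jumpChainLaw_eq_sum, ae_iff]
  simp only [Measure.coe_finsetSum, Finset.sum_apply, Measure.smul_apply, smul_eq_mul]
  refine Finset.sum_eq_zero fun y _ => ?_
  rcases eq_or_ne y x with rfl | hxy
  · rw [jumpMeasure_singleton hr, hdiag]; simp
  · refine mul_eq_zero_of_right _ ?_
    rw [← ae_iff, ae_map_iff (measurable_consPath x).aemeasurable]
    · filter_upwards [jumpChainLaw_ae_zero r y] with Y hY
      change Y 0 ≠ x
      rwa [hY]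
    · exact (measurableSet_eq_fun (measurable_pi_apply 1) (measurable_pi_apply 0)).compl

/-- The holding times play no role for the order of the returns to `A` and `B`. -/
theorem driverLaw_returnTime_lt (hr : ∀ x, exitRate r x ≠ 0) (hdiag : ∀ x, r x x = 0)
    {A B : Set V} (hAB : Disjoint A B) {x : V} (hx : x ∈ A) :
    driverLaw r x {p | returnTime (chainPath r p) B < returnTime (chainPath r p) A}
      = jumpChainLaw r x (hitEvent B A) := by
  have := isProbabilityMeasure_expMeasure (r := 1) one_pos
  have hae : ∀ᵐ p ∂(driverLaw r x), (p.1 0 = x ∧ p.1 1 ≠ p.1 0) ∧ ∀ k, 0 < p.2 k := by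
    refine Filter.Eventually.and ?_ ?_
    · exact Measure.quasiMeasurePreserving_fst.ae
        ((jumpChainLaw_ae_zero r x).and (jumpChainLaw_ae_one_ne hr hdiag x))
    · exact Measure.quasiMeasurePreserving_snd.ae holdingTimes_ae_pos
  have h1 : {p | returnTime (chainPath r p) B < returnTime (chainPath r p) A}
      =ᵐ[driverLaw r x] (Prod.fst ⁻¹' hitEvent B A) := by
    filter_upwards [hae] with p hp
    exact propext (returnTime_lt_iff hr hp.2 hAB (hp.1.1 ▸ hx) hp.1.2)
  rw [measure_congr h1, driverLaw]
  have := (measurePreserving_fst (μ := jumpChainLaw r x)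
    (ν := Measure.infinitePi fun _ : ℕ => expMeasure 1)).measure_preimage
    (measurableSet_hitEvent B A).nullMeasurableSet
  exact this

open Classical in
/-- The equilibrium potential: the probability that the jump chain started in `x`, time zero
included, hits `B` before `A`. -/
def equilibriumPotential (r : V → V → ℝ≥0) (B A : Set V) (x : V) : ℝ :=
  if x ∈ B then 1 else if x ∈ A then 0 else (jumpChainLaw r x).real (hitEvent B A)

/-- The first-step equation for the probability to hit `B` before `A` at a positive time. It holds
at every `x`, the points of `A` and `B` included. -/
theorem exitRate_mul_hitEvent (hr : ∀ x, exitRate r x ≠ 0) {A B : Set V} (hAB : Disjoint A B)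
    (x : V) :
    (exitRate r x : ℝ) * (jumpChainLaw r x).real (hitEvent B A)
      = ∑ y, (r x y : ℝ) * equilibriumPotential r B A y := by
  have hstep : ∀ y, (jumpChainLaw r y).real (consPath x ⁻¹' hitEvent B A)
      = equilibriumPotential r B A y := by
    intro y
    have hpre : ∀ Y : ℕ → V, consPath x Y ∈ hitEvent B A ↔
        Y 0 ∉ A ∧ (Y 0 ∈ B ∨ Y ∈ hitEvent B A) := by
      intro Y
      constructor
      · rintro ⟨n, hn, hB, hA⟩
        obtain ⟨n, rfl⟩ := Nat.exists_eq_succ_of_ne_zero (by omega : n ≠ 0)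
        refine ⟨hA 1 le_rfl (by omega), ?_⟩
        rcases Nat.eq_zero_or_pos n with rfl | hn0
        · exact Or.inl hB
        · exact Or.inr ⟨n, hn0, hB, fun k hk hkn => hA (k + 1) (by omega) (by omega)⟩
      · rintro ⟨h0, hB | ⟨n, hn, hB, hA⟩⟩
        · refine ⟨1, le_rfl, hB, fun k hk hk1 => ?_⟩
          obtain rfl : k = 1 := by omega
          exact h0
        · refine ⟨n + 1, by omega, hB, fun k hk hkn => ?_⟩
          obtain ⟨k, rfl⟩ := Nat.exists_eq_succ_of_ne_zero (by omega : k ≠ 0)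
          rcases Nat.eq_zero_or_pos k with rfl | hk0
          · exact h0
          · exact hA k hk0 (by omega)
    rw [equilibriumPotential]
    split_ifs with hB hA
    · have : consPath x ⁻¹' hitEvent B A =ᵐ[jumpChainLaw r y] Set.univ := by
        filter_upwards [jumpChainLaw_ae_zero r y] with Y hY
        refine propext ⟨fun _ => trivial, fun _ => (hpre Y).2 ?_⟩
        rw [hY]
        exact ⟨Set.disjoint_right.1 hAB hB, Or.inl hB⟩
      rw [measureReal_congr this, probReal_univ]
    · have : consPath x ⁻¹' hitEvent B A =ᵐ[jumpChainLaw r y] (∅ : Set _) := by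
        filter_upwards [jumpChainLaw_ae_zero r y] with Y hY
        refine propext ⟨fun h => ?_, fun h => h.elim⟩
        have := ((hpre Y).1 h).1
        rw [hY] at this
        exact this hA
      rw [measureReal_congr this, measureReal_empty]
    · have : consPath x ⁻¹' hitEvent B A =ᵐ[jumpChainLaw r y] hitEvent B A := by
        filter_upwards [jumpChainLaw_ae_zero r y] with Y hY
        refine propext ((hpre Y).trans ?_)
        change _ ↔ Y ∈ hitEvent B A
        rw [hY]
        simp only [hA, hB, not_false_eq_true, true_and, false_or]
      rw [measureReal_congr this]
  have h := congrArg (fun μ : Measure (ℕ → V) => μ.real (hitEvent B A)) (jumpChainLaw_eq_sum r x)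
  simp only [measureReal_def, Measure.coe_finsetSum, Finset.sum_apply, Measure.smul_apply,
    smul_eq_mul, Measure.map_apply (measurable_consPath x) (measurableSet_hitEvent B A)] at h
  rw [ENNReal.toReal_sum fun y _ => ENNReal.mul_ne_top (measure_ne_top _ _) (measure_ne_top _ _)]
    at h
  rw [measureReal_def, h, Finset.mul_sum]
  refine Finset.sum_congr rfl fun y _ => ?_
  rw [ENNReal.toReal_mul, ← measureReal_def (μ := jumpChainLaw r y), hstep,
    jumpMeasure_singleton hr, ← mul_assoc]
  congr 1
  have : (exitRate r x : ℝ) ≠ 0 := by exact_mod_cast hr x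
  simp only [ENNReal.coe_toReal, NNReal.coe_div]
  field_simp

end HittingProbabilities

/-! ### Dirichlet forms and the comparison of reversible chains -/

section Dirichlet

variable {V : Type*} [Fintype V]

/-- The Dirichlet form of the network with conductances `c`. -/
def dirichletForm (c : V → V → ℝ) (f : V → ℝ) : ℝ := (∑ x, ∑ y, c x y * (f y - f x) ^ 2) / 2

theorem sum_conductance_mul_sub_mul_sub {c : V → V → ℝ} (hc : ∀ x y, c x y = c y x)
    (f g : V → ℝ) :
    ∑ x, ∑ y, c x y * (f y - f x) * (g y - g x)
      = -2 * ∑ x, g x * ∑ y, c x y * (f y - f x) := by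
  have h1 : ∑ x, ∑ y, c x y * (f y - f x) * g y = -∑ x, g x * ∑ y, c x y * (f y - f x) := by
    rw [Finset.sum_comm, ← Finset.sum_neg_distrib]
    refine Finset.sum_congr rfl fun x _ => ?_
    rw [Finset.mul_sum, ← Finset.sum_neg_distrib]
    refine Finset.sum_congr rfl fun y _ => ?_
    rw [hc y x]; ring
  have h2 : ∑ x, ∑ y, c x y * (f y - f x) * g x = ∑ x, g x * ∑ y, c x y * (f y - f x) := by
    refine Finset.sum_congr rfl fun x _ => ?_
    rw [Finset.mul_sum]
    exact Finset.sum_congr rfl fun y _ => by ring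
  simp only [mul_sub (_ * _), Finset.sum_sub_distrib]
  rw [h1, h2]; ring

open Classical in
/-- The current that leaves `A` at unit voltage is the energy of the potential. -/
theorem sum_current_eq_dirichletForm {c : V → V → ℝ} (hc : ∀ x y, c x y = c y x) {A B : Set V}
    {f : V → ℝ} (hA : ∀ x ∈ A, f x = 0) (hB : ∀ x ∈ B, f x = 1)
    (hf : ∀ x, x ∉ A → x ∉ B → ∑ y, c x y * (f y - f x) = 0) :
    ∑ x with x ∈ A, ∑ y, c x y * f y = dirichletForm c f := by
  have h := sum_conductance_mul_sub_mul_sub hc f (fun x => f x - 1)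
  have h' : dirichletForm c f = -∑ x, (f x - 1) * ∑ y, c x y * (f y - f x) := by
    have : ∀ x y, c x y * (f y - f x) * ((f y - 1) - (f x - 1)) = c x y * (f y - f x) ^ 2 :=
      fun x y => by ring
    simp only [this] at h
    rw [dirichletForm, h]; ring
  rw [h', ← Finset.sum_neg_distrib, Finset.sum_filter]
  refine Finset.sum_congr rfl fun x _ => ?_
  split_ifs with hxA
  · rw [hA x hxA]; simp
  · by_cases hxB : x ∈ B
    · rw [hB x hxB]; simp
    · rw [hf x hxA hxB]; simp

/-- The Dirichlet principle: among the functions with given values on a set, one that is harmonic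
off that set has the least energy. -/
theorem dirichletForm_le_of_harmonic {c : V → V → ℝ} (hc : ∀ x y, c x y = c y x)
    (hc0 : ∀ x y, 0 ≤ c x y) {f g : V → ℝ}
    (h : ∀ x, f x = g x ∨ ∑ y, c x y * (f y - f x) = 0) :
    dirichletForm c f ≤ dirichletForm c g := by
  have hortho := sum_conductance_mul_sub_mul_sub hc f (fun x => g x - f x)
  have h0 : ∑ x, (g x - f x) * ∑ y, c x y * (f y - f x) = 0 := by
    refine Finset.sum_eq_zero fun x _ => ?_
    rcases h x with hx | hx
    · rw [hx]; simp
    · rw [hx]; simp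
  rw [h0, mul_zero] at hortho
  have hnn : 0 ≤ dirichletForm c (fun x => g x - f x) :=
    div_nonneg (Finset.sum_nonneg fun x _ => Finset.sum_nonneg fun y _ =>
      mul_nonneg (hc0 x y) (sq_nonneg _)) zero_le_two
  have hsum : dirichletForm c g = dirichletForm c f + dirichletForm c (fun x => g x - f x)
      + ∑ x, ∑ y, c x y * (f y - f x) * ((g y - f y) - (g x - f x)) := by
    have : ∀ x y, c x y * (g y - g x) ^ 2 = c x y * (f y - f x) ^ 2
        + c x y * ((g y - f y) - (g x - f x)) ^ 2
        + 2 * (c x y * (f y - f x) * ((g y - f y) - (g x - f x))) := fun x y => by ring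
    simp only [dirichletForm, this, Finset.sum_add_distrib, ← Finset.mul_sum]
    ring
  rw [hsum, hortho]
  linarith

theorem dirichletForm_mono {c c' : V → V → ℝ} {a : ℝ} (h : ∀ x y, c x y ≤ a * c' x y)
    (f : V → ℝ) : dirichletForm c f ≤ a * dirichletForm c' f := by
  rw [dirichletForm, dirichletForm, ← mul_div_assoc, Finset.mul_sum]
  refine div_le_div_of_nonneg_right (Finset.sum_le_sum fun x _ => ?_) zero_le_two
  rw [Finset.mul_sum]
  refine Finset.sum_le_sum fun y _ => ?_
  rw [← mul_assoc]
  exact mul_le_mul_of_nonneg_right (h x y) (sq_nonneg _)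

end Dirichlet

section Comparison

variable {V : Type*} [Fintype V] [MeasurableSpace V] [MeasurableSingletonClass V]

/-- The equilibrium potential is harmonic off `A ∪ B`. -/
theorem equilibriumPotential_harmonic {r : V → V → ℝ≥0} (hr : ∀ x, exitRate r x ≠ 0) (w : V → ℝ)
    {A B : Set V} (hAB : Disjoint A B) {x : V} (hxA : x ∉ A) (hxB : x ∉ B) :
    ∑ y, w x * (r x y : ℝ) * (equilibriumPotential r B A y - equilibriumPotential r B A x) = 0 := by
  have h := exitRate_mul_hitEvent hr hAB x
  have hx : equilibriumPotential r B A x = (jumpChainLaw r x).real (hitEvent B A) := by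
    rw [equilibriumPotential, if_neg hxB, if_neg hxA]
  rw [← hx, exitRate, NNReal.coe_sum, Finset.sum_mul, ← sub_eq_zero, ← Finset.sum_sub_distrib] at h
  have : ∀ y, w x * (r x y : ℝ) * (equilibriumPotential r B A y - equilibriumPotential r B A x)
      = -w x * ((r x y : ℝ) * equilibriumPotential r B A x
        - (r x y : ℝ) * equilibriumPotential r B A y) := fun y => by ring
  simp only [this, ← Finset.mul_sum]
  rw [h, mul_zero]

open Classical in
/-- The capacity of the pair `(A, B)` written through escape probabilities equals the energy of the
equilibrium potential. -/
theorem sum_escape_eq_dirichletForm {r : V → V → ℝ≥0} (hr : ∀ x, exitRate r x ≠ 0) {w : V → ℝ}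
    (hw : ∀ x y, w x * r x y = w y * r y x) {A B : Set V} (hAB : Disjoint A B) :
    ∑ x with x ∈ A, w x * (exitRate r x * (jumpChainLaw r x).real (hitEvent B A))
      = dirichletForm (fun x y => w x * r x y) (equilibriumPotential r B A) := by
  rw [← sum_current_eq_dirichletForm (A := A) (B := B) hw]
  · refine Finset.sum_congr rfl fun x _ => ?_
    rw [exitRate_mul_hitEvent hr hAB, Finset.mul_sum]
    exact Finset.sum_congr rfl fun y _ => by ring
  · intro x hx
    rw [equilibriumPotential, if_neg (Set.disjoint_left.1 hAB hx), if_pos hx]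
  · intro x hx
    rw [equilibriumPotential, if_pos hx]
  · exact fun x hxA hxB => equilibriumPotential_harmonic hr w hAB hxA hxB

open Classical in
/-- The energy of the equilibrium potential is monotone in the conductances: the potential of the
second chain is a test function for the first. -/
theorem dirichletForm_equilibriumPotential_le {r r' : V → V → ℝ≥0} (hr : ∀ x, exitRate r x ≠ 0)
    {w w' : V → ℝ} (hw0 : ∀ x, 0 ≤ w x) (hw : ∀ x y, w x * r x y = w y * r y x) {a : ℝ}
    (hc : ∀ x y, w x * r x y ≤ a * (w' x * r' x y)) {A B : Set V} (hAB : Disjoint A B) :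
    dirichletForm (fun x y => w x * r x y) (equilibriumPotential r B A)
      ≤ a * dirichletForm (fun x y => w' x * r' x y) (equilibriumPotential r' B A) := by
  refine (dirichletForm_le_of_harmonic hw (fun x y => mul_nonneg (hw0 x) (NNReal.coe_nonneg _))
    fun x => ?_).trans (dirichletForm_mono hc _)
  by_cases hxB : x ∈ B
  · left; simp [equilibriumPotential, hxB]
  · by_cases hxA : x ∈ A
    · left; simp [equilibriumPotential, hxA, hxB]
    · exact Or.inr (equilibriumPotential_harmonic hr w hAB hxA hxB)

open Classical in
theorem returnBeforeProb_cond {r : V → V → ℝ≥0} (hr : ∀ x, exitRate r x ≠ 0)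
    (hdiag : ∀ x, r x x = 0) (μ : Measure V) [IsFiniteMeasure μ] (hμ : ∀ x, 0 < μ.real {x})
    {A B : Set V} (hA : A.Nonempty) (hAB : Disjoint A B) :
    returnBeforeProb r (μ[|A]) B A = ENNReal.ofReal
      ((∑ x with x ∈ A, μ.real {x} * (jumpChainLaw r x).real (hitEvent B A))
        / ∑ x with x ∈ A, μ.real {x}) := by
  have hAm : MeasurableSet A := (Set.toFinite A).measurableSet
  have hfilt : (↑(Finset.univ.filter (· ∈ A)) : Set V) = A := by ext; simp
  have hμA : μ A = ENNReal.ofReal (∑ x with x ∈ A, μ.real {x}) := by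
    rw [← hfilt, ← sum_measure_singleton, ENNReal.ofReal_sum_of_nonneg fun _ _ => measureReal_nonneg,
      hfilt]
    exact Finset.sum_congr rfl fun x _ => (ofReal_measureReal).symm
  have hpos : 0 < ∑ x with x ∈ A, μ.real {x} := by
    obtain ⟨x, hx⟩ := hA
    exact Finset.sum_pos (fun y _ => hμ y) ⟨x, by simpa using hx⟩
  rw [returnBeforeProb, lintegral_fintype, ENNReal.ofReal_div_of_pos hpos, ← hμA,
    ENNReal.ofReal_sum_of_nonneg fun _ _ => mul_nonneg measureReal_nonneg measureReal_nonneg,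
    Finset.sum_filter, div_eq_mul_inv, Finset.sum_mul]
  refine Finset.sum_congr rfl fun x _ => ?_
  rw [cond_apply hAm]
  split_ifs with hx
  · rw [driverLaw_returnTime_lt hr hdiag hAB hx, Set.inter_eq_right.2 (by simpa using hx),
      ENNReal.ofReal_mul measureReal_nonneg, ofReal_measureReal, ofReal_measureReal]
    ring
  · have : A ∩ {x} = ∅ := by ext y; simp only [Set.mem_inter_iff, Set.mem_singleton_iff,
      Set.mem_empty_iff_false, iff_false, not_and]; rintro hy rfl; exact hx hy
    rw [this]; simp

/-- Two reversible chains with comparable stationary weights, comparable conductances and exit rates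
between the same bounds have comparable escape probabilities. -/
theorem returnBeforeProb_le {r r' : V → V → ℝ≥0} (hdiag : ∀ x, r x x = 0)
    (hdiag' : ∀ x, r' x x = 0) (μ μ' : Measure V) [IsFiniteMeasure μ] [IsFiniteMeasure μ']
    (hμ : ∀ x, 0 < μ.real {x}) (hμ' : ∀ x, 0 < μ'.real {x})
    (hrev : ∀ x y, μ.real {x} * r x y = μ.real {y} * r y x)
    (hrev' : ∀ x y, μ'.real {x} * r' x y = μ'.real {y} * r' y x)
    {a q R : ℝ} (hq : 0 < q) (hR : 0 < R) (ha : 0 < a)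
    (hrate : ∀ x, q ≤ exitRate r x) (hrate0 : ∀ x, 0 < exitRate r' x)
    (hrate' : ∀ x, exitRate r' x ≤ R) (hw : ∀ x, μ'.real {x} ≤ a * μ.real {x})
    (hc : ∀ x y, μ.real {x} * r x y ≤ a * (μ'.real {x} * r' x y))
    {A B : Set V} (hA : A.Nonempty) (hAB : Disjoint A B) :
    returnBeforeProb r (μ[|A]) B A
      ≤ ENNReal.ofReal (a ^ 2 * (R / q)) * returnBeforeProb r' (μ'[|A]) B A := by
  classical
  have hr : ∀ x, exitRate r x ≠ 0 := fun x h => by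
    have := hrate x
    rw [h] at this
    exact absurd this (not_le.2 (by simpa using hq))
  have hr' : ∀ x, exitRate r' x ≠ 0 := fun x => (hrate0 x).ne'
  rw [returnBeforeProb_cond hr hdiag μ hμ hA hAB, returnBeforeProb_cond hr' hdiag' μ' hμ' hA hAB,
    ← ENNReal.ofReal_mul (by positivity)]
  refine ENNReal.ofReal_le_ofReal ?_
  set S := ∑ x with x ∈ A, μ.real {x} * (jumpChainLaw r x).real (hitEvent B A) with hS
  set S' := ∑ x with x ∈ A, μ'.real {x} * (jumpChainLaw r' x).real (hitEvent B A) with hS'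
  set m := ∑ x with x ∈ A, μ.real {x} with hm
  set m' := ∑ x with x ∈ A, μ'.real {x} with hm'
  have hpos : ∀ (ν : Measure V), (∀ x, 0 < ν.real {x}) → 0 < ∑ x with x ∈ A, ν.real {x} := by
    intro ν hν
    obtain ⟨x, hx⟩ := hA
    exact Finset.sum_pos (fun y _ => hν y) ⟨x, by simpa using hx⟩
  have hm0 : 0 < m := hpos μ hμ
  have hm0' : 0 < m' := hpos μ' hμ'
  have hmm : m' ≤ a * m := by
    rw [hm, Finset.mul_sum]
    exact Finset.sum_le_sum fun x _ => hw x
  have hS0 : 0 ≤ S' := Finset.sum_nonneg fun _ _ => mul_nonneg measureReal_nonneg measureReal_nonneg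
  have h1 : q * S ≤ dirichletForm (fun x y => μ.real {x} * r x y) (equilibriumPotential r B A) := by
    rw [← sum_escape_eq_dirichletForm hr hrev hAB, hS, Finset.mul_sum]
    refine Finset.sum_le_sum fun x _ => ?_
    have := mul_le_mul_of_nonneg_right (hrate x)
      (mul_nonneg (measureReal_nonneg (μ := μ) (s := {x}))
        (measureReal_nonneg (μ := jumpChainLaw r x) (s := hitEvent B A)))
    linarith
  have h2 : dirichletForm (fun x y => μ'.real {x} * r' x y) (equilibriumPotential r' B A)
      ≤ R * S' := by
    rw [← sum_escape_eq_dirichletForm hr' hrev' hAB, hS', Finset.mul_sum]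
    refine Finset.sum_le_sum fun x _ => ?_
    have := mul_le_mul_of_nonneg_right (hrate' x)
      (mul_nonneg (measureReal_nonneg (μ := μ') (s := {x}))
        (measureReal_nonneg (μ := jumpChainLaw r' x) (s := hitEvent B A)))
    linarith
  have h3 := dirichletForm_equilibriumPotential_le hr (fun x => (hμ x).le) hrev hc hAB
  have h4 : q * S ≤ a * (R * S') := h1.trans (h3.trans (mul_le_mul_of_nonneg_left h2 ha.le))
  have h5 : S ≤ a * (R * S') / q := by
    rw [le_div_iff₀ hq]; linarith
  calc S / m ≤ (a * (R * S') / q) / m := div_le_div_of_nonneg_right h5 hm0.le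
    _ ≤ (a * (R * S') / q) * (a / m') := by
        rw [div_eq_mul_inv _ m]
        refine mul_le_mul_of_nonneg_left ?_ (by positivity)
        rw [inv_le_comm₀ hm0 (by positivity), inv_div, div_le_iff₀ ha]
        linarith
    _ = a ^ 2 * (R / q) * (S' / m') := by field_simp

/-- Metastability passes from one chain to another when all escape probabilities are comparable. -/
theorem IsMetastable.of_comparable {r r' : V → V → ℝ≥0} {μ μ' : Measure V} {ρ b : ℝ} (hb : 0 < b)
    (h1 : ∀ A B : Set V, A.Nonempty → Disjoint A B →
      returnBeforeProb r (μ[|A]) B A ≤ ENNReal.ofReal b * returnBeforeProb r' (μ'[|A]) B A)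
    (h2 : ∀ A B : Set V, A.Nonempty → Disjoint A B →
      returnBeforeProb r' (μ'[|A]) B A ≤ ENNReal.ofReal b * returnBeforeProb r (μ[|A]) B A)
    {K : ℕ} {M : Fin K → Set V} (h : IsMetastable r' μ' ρ M) :
    IsMetastable r μ (b ^ 2 * ρ) M := by
  obtain ⟨hne, hdisj, hcompl, hρ⟩ := h
  refine ⟨hne, hdisj, hcompl, ?_⟩
  have hb0 : ENNReal.ofReal b ≠ 0 := by simpa using hb
  have hbt : ENNReal.ofReal b ≠ ∞ := ENNReal.ofReal_ne_top
  set num := ⨆ j, returnBeforeProb r (μ[|M j]) ((⋃ i, M i) \ M j) (M j)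
  set num' := ⨆ j, returnBeforeProb r' (μ'[|M j]) ((⋃ i, M i) \ M j) (M j)
  set den := ⨅ X ∈ {X : Set V | X.Nonempty ∧ X ⊆ (⋃ i, M i)ᶜ},
    returnBeforeProb r (μ[|X]) (⋃ i, M i) X
  set den' := ⨅ X ∈ {X : Set V | X.Nonempty ∧ X ⊆ (⋃ i, M i)ᶜ},
    returnBeforeProb r' (μ'[|X]) (⋃ i, M i) X
  have hnum : num ≤ ENNReal.ofReal b * num' := by
    refine iSup_le fun j => (h1 _ _ (hne j) Set.disjoint_sdiff_right).trans ?_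
    gcongr
    exact le_iSup (fun j => returnBeforeProb r' (μ'[|M j]) ((⋃ i, M i) \ M j) (M j)) j
  have hden : den' / ENNReal.ofReal b ≤ den := by
    refine le_iInf₂ fun X hX => ?_
    refine ENNReal.div_le_of_le_mul' ((iInf₂_le X hX).trans (h2 _ _ hX.1 ?_))
    exact Set.disjoint_left.2 fun x hx hx' => hX.2 hx hx'
  calc (K : ℝ≥0∞) * num / den
      ≤ K * (ENNReal.ofReal b * num') / (den' / ENNReal.ofReal b) := by gcongr
    _ = ENNReal.ofReal b ^ 2 * (K * num' / den') := by
        rw [ENNReal.div_eq_inv_mul, ENNReal.inv_div (Or.inl hbt) (Or.inl hb0), div_eq_mul_inv,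
          div_eq_mul_inv]
        ring
    _ ≤ ENNReal.ofReal b ^ 2 * ENNReal.ofReal ρ := by gcongr
    _ = ENNReal.ofReal (b ^ 2 * ρ) := by
        rw [ENNReal.ofReal_mul (by positivity), ENNReal.ofReal_pow hb.le]

end Comparison

/-! ### Glauber dynamics -/

section Glauber

variable {N : ℕ} {β : ℝ} {H H' : Config N → ℝ}

theorem not_singleFlip_self (σ : Config N) : ¬ SingleFlip σ σ := by
  rintro ⟨i, hi⟩
  have := congrFun hi i
  rw [Function.update_self] at this
  exact units_ne_neg_self (σ i) this

theorem SingleFlip.symm {σ σ' : Config N} (h : SingleFlip σ σ') : SingleFlip σ' σ := by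
  obtain ⟨i, rfl⟩ := h
  exact ⟨i, by simp⟩

theorem glauberRate_self (σ : Config N) : glauberRate β H σ σ = 0 := by
  rw [glauberRate, if_neg (not_singleFlip_self σ)]

theorem partitionFunction_pos (β : ℝ) (H : Config N → ℝ) : 0 < partitionFunction β H :=
  Finset.sum_pos (fun _ _ => Real.exp_pos _) Finset.univ_nonempty

instance (β : ℝ) (H : Config N → ℝ) : IsFiniteMeasure (gibbsMeasure β H) := by
  constructor
  rw [gibbsMeasure]
  simp only [Measure.coe_finsetSum, Finset.sum_apply, Measure.smul_apply, smul_eq_mul,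
    measure_univ, mul_one]
  exact ENNReal.sum_lt_top.2 fun _ _ => ENNReal.ofReal_lt_top

theorem gibbsMeasure_singleton (β : ℝ) (H : Config N → ℝ) (σ : Config N) :
    (gibbsMeasure β H).real {σ} = Real.exp (-β * H σ) / partitionFunction β H := by
  have h0 : 0 ≤ Real.exp (-β * H σ) / partitionFunction β H :=
    div_nonneg (Real.exp_pos _).le (partitionFunction_pos β H).le
  rw [measureReal_def, gibbsMeasure, ← ENNReal.toReal_ofReal h0]
  congr 1
  classical
  simp only [Measure.coe_finsetSum, Finset.sum_apply, Measure.smul_apply, smul_eq_mul,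
    Measure.dirac_apply' _ (measurableSet_singleton σ), Set.indicator_apply,
    Set.mem_singleton_iff, Pi.one_apply, mul_ite, mul_one, mul_zero]
  simp

theorem exp_mul_glauberRate_of_singleFlip {σ σ' : Config N} (h : SingleFlip σ σ') :
    Real.exp (-β * H σ) * glauberRate β H σ σ' = Real.exp (-β * max (H σ) (H σ')) := by
  rw [glauberRate, if_pos h, Real.coe_toNNReal _ (Real.exp_pos _).le, ← Real.exp_add]
  congr 1
  have : max (H σ) (H σ') = H σ + max (H σ' - H σ) 0 := by
    rw [← max_add_add_left, max_comm]; simp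
  rw [this]; ring

theorem glauberRate_of_not_singleFlip {σ σ' : Config N} (h : ¬ SingleFlip σ σ') :
    glauberRate β H σ σ' = 0 := by
  rw [glauberRate, if_neg h]

/-- Detailed balance. -/
theorem gibbsMeasure_mul_glauberRate_comm (β : ℝ) (H : Config N → ℝ) (σ σ' : Config N) :
    (gibbsMeasure β H).real {σ} * glauberRate β H σ σ'
      = (gibbsMeasure β H).real {σ'} * glauberRate β H σ' σ := by
  by_cases h : SingleFlip σ σ'
  · rw [gibbsMeasure_singleton, gibbsMeasure_singleton, div_mul_eq_mul_div, div_mul_eq_mul_div,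
      exp_mul_glauberRate_of_singleFlip h, exp_mul_glauberRate_of_singleFlip h.symm, max_comm]
  · rw [glauberRate_of_not_singleFlip h, glauberRate_of_not_singleFlip fun h' => h h'.symm]
    simp

theorem partitionFunction_le (hβ : 0 ≤ β) {δ : ℝ} (h : ∀ σ, |H σ - H' σ| ≤ δ) :
    partitionFunction β H' ≤ Real.exp (β * δ) * partitionFunction β H := by
  rw [partitionFunction, partitionFunction, Finset.mul_sum]
  refine Finset.sum_le_sum fun σ _ => ?_
  rw [← Real.exp_add, Real.exp_le_exp]
  nlinarith [(abs_le.1 (h σ)).2]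

/-- One factor `exp (β * δ)` is due to the Boltzmann weight, the other to the partition function. -/
theorem exp_div_partitionFunction_le (hβ : 0 ≤ β) {δ : ℝ} (h : ∀ σ, |H σ - H' σ| ≤ δ) {x y : ℝ}
    (hxy : y ≤ x + δ) :
    Real.exp (-β * x) / partitionFunction β H
      ≤ Real.exp (2 * β * δ) * (Real.exp (-β * y) / partitionFunction β H') := by
  have hZ := partitionFunction_pos β H
  have hZ' := partitionFunction_pos β H'
  rw [← mul_div_assoc, div_le_div_iff₀ hZ hZ']
  have h1 : Real.exp (-β * x) ≤ Real.exp (β * δ) * Real.exp (-β * y) := by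
    rw [← Real.exp_add, Real.exp_le_exp]; nlinarith
  calc Real.exp (-β * x) * partitionFunction β H'
      ≤ (Real.exp (β * δ) * Real.exp (-β * y)) *
          (Real.exp (β * δ) * partitionFunction β H) :=
        mul_le_mul h1 (partitionFunction_le hβ h) hZ'.le (by positivity)
    _ = Real.exp (2 * β * δ) * Real.exp (-β * y) * partitionFunction β H := by
        rw [show 2 * β * δ = β * δ + β * δ by ring, Real.exp_add]; ring

theorem gibbsMeasure_le (hβ : 0 ≤ β) {δ : ℝ} (h : ∀ σ, |H σ - H' σ| ≤ δ) (σ : Config N) :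
    (gibbsMeasure β H).real {σ} ≤ Real.exp (2 * β * δ) * (gibbsMeasure β H').real {σ} := by
  rw [gibbsMeasure_singleton, gibbsMeasure_singleton]
  exact exp_div_partitionFunction_le hβ h (by linarith [(abs_le.1 (h σ)).1])

theorem conductance_le (hβ : 0 ≤ β) {δ : ℝ} (h : ∀ σ, |H σ - H' σ| ≤ δ) (σ σ' : Config N) :
    (gibbsMeasure β H).real {σ} * glauberRate β H σ σ'
      ≤ Real.exp (2 * β * δ) * ((gibbsMeasure β H').real {σ} * glauberRate β H' σ σ') := by
  by_cases hf : SingleFlip σ σ'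
  · rw [gibbsMeasure_singleton, gibbsMeasure_singleton, div_mul_eq_mul_div, div_mul_eq_mul_div,
      exp_mul_glauberRate_of_singleFlip hf, exp_mul_glauberRate_of_singleFlip hf]
    refine exp_div_partitionFunction_le hβ h ?_
    rw [← max_add_add_right]
    exact max_le_max (by linarith [(abs_le.1 (h σ)).1]) (by linarith [(abs_le.1 (h σ')).1])
  · simp [glauberRate_of_not_singleFlip hf]

theorem exitRate_glauberRate_le (hβ : 0 ≤ β) (H : Config N → ℝ) (σ : Config N) :
    (exitRate (glauberRate β H) σ : ℝ) ≤ N := by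
  classical
  rw [exitRate, NNReal.coe_sum]
  calc ∑ σ', (glauberRate β H σ σ' : ℝ)
      ≤ ∑ σ' : Config N, ∑ i, if σ' = Function.update σ i (-σ i) then (1 : ℝ) else 0 := by
        refine Finset.sum_le_sum fun σ' _ => ?_
        by_cases h : SingleFlip σ σ'
        · obtain ⟨i, hi⟩ := id h
          rw [glauberRate, if_pos h, Real.coe_toNNReal _ (Real.exp_pos _).le]
          refine le_trans (Real.exp_le_one_iff.2 ?_) (Finset.single_le_sum
            (f := fun i => if σ' = Function.update σ i (-σ i) then (1 : ℝ) else 0)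
            (fun j _ => by split_ifs <;> norm_num) (Finset.mem_univ i) |>.trans' ?_)
          · nlinarith [le_max_right (H σ' - H σ) 0]
          · simp [hi]
        · rw [glauberRate_of_not_singleFlip h]
          exact Finset.sum_nonneg fun j _ => by split_ifs <;> norm_num
    _ = N := by rw [Finset.sum_comm]; simp

theorem le_exitRate_glauberRate (hβ : 0 ≤ β) (hN : 0 < N) {D : ℝ}
    (hD : ∀ σ σ', SingleFlip σ σ' → |H σ' - H σ| ≤ D) (σ : Config N) :
    Real.exp (-β * D) ≤ exitRate (glauberRate β H) σ := by
  set σ' : Config N := Function.update σ ⟨0, hN⟩ (-σ ⟨0, hN⟩)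
  have hf : SingleFlip σ σ' := ⟨_, rfl⟩
  have h1 : Real.exp (-β * D) ≤ glauberRate β H σ σ' := by
    rw [glauberRate, if_pos hf, Real.coe_toNNReal _ (Real.exp_pos _).le, Real.exp_le_exp]
    have := hD σ σ' hf
    have : max (H σ' - H σ) 0 ≤ D := max_le ((le_abs_self _).trans this) ((abs_nonneg _).trans this)
    nlinarith
  refine h1.trans ?_
  exact_mod_cast Finset.single_le_sum (f := fun y => glauberRate β H σ y) (fun _ _ => zero_le)
    (Finset.mem_univ σ')

theorem returnBeforeProb_glauber_le (hβ : 0 ≤ β) (hN : 0 < N) {δ D : ℝ}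
    (h : ∀ σ, |H σ - H' σ| ≤ δ) (hD : ∀ σ σ', SingleFlip σ σ' → |H σ' - H σ| ≤ D)
    (hD' : ∀ σ σ', SingleFlip σ σ' → |H' σ' - H' σ| ≤ D)
    {A B : Set (Config N)} (hA : A.Nonempty) (hAB : Disjoint A B) :
    returnBeforeProb (glauberRate β H) ((gibbsMeasure β H)[|A]) B A
      ≤ ENNReal.ofReal (N * Real.exp (4 * β * δ + β * D)) *
        returnBeforeProb (glauberRate β H') ((gibbsMeasure β H')[|A]) B A := by
  have hpos : ∀ (H : Config N → ℝ) σ, 0 < (gibbsMeasure β H).real {σ} := fun H σ => by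
    rw [gibbsMeasure_singleton]; exact div_pos (Real.exp_pos _) (partitionFunction_pos β H)
  have h' : ∀ σ, |H' σ - H σ| ≤ δ := fun σ => by rw [abs_sub_comm]; exact h σ
  refine (returnBeforeProb_le glauberRate_self glauberRate_self (gibbsMeasure β H)
    (gibbsMeasure β H') (hpos H) (hpos H') (gibbsMeasure_mul_glauberRate_comm β H)
    (gibbsMeasure_mul_glauberRate_comm β H') (Real.exp_pos (-β * D))
    (Nat.cast_pos.2 hN) (Real.exp_pos (2 * β * δ)) (le_exitRate_glauberRate hβ hN hD)
    (fun σ => ?_) (exitRate_glauberRate_le hβ H')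
    (gibbsMeasure_le hβ h') (conductance_le hβ h) hA hAB).trans (le_of_eq ?_)
  · have := (Real.exp_pos _).trans_le (le_exitRate_glauberRate hβ hN hD' σ)
    exact_mod_cast this
  · congr 2
    rw [neg_mul, Real.exp_neg, div_inv_eq_mul, ← Real.exp_nat_mul, Real.exp_add,
      show ((2 : ℕ) : ℝ) * (2 * β * δ) = 4 * β * δ by push_cast; ring]
    ring

/-- Metastability is stable under perturbations of the Hamiltonian, with a loss that is exponential
in the size of the perturbation. -/
theorem GlauberMetastable.of_abs_sub_le (hβ : 0 ≤ β) (hN : 0 < N) {δ D ρ : ℝ}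
    (h : ∀ σ, |H σ - H' σ| ≤ δ) (hD : ∀ σ σ', SingleFlip σ σ' → |H σ' - H σ| ≤ D)
    (hD' : ∀ σ σ', SingleFlip σ σ' → |H' σ' - H' σ| ≤ D) {K : ℕ} {M : Fin K → Set (Config N)}
    (hM : GlauberMetastable β H' ρ M) :
    GlauberMetastable β H ((N * Real.exp (4 * β * δ + β * D)) ^ 2 * ρ) M := by
  have hN' : (0 : ℝ) < N := Nat.cast_pos.2 hN
  exact IsMetastable.of_comparable (by positivity)
    (fun A B hA hAB => returnBeforeProb_glauber_le hβ hN h hD hD' hA hAB)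
    (fun A B hA hAB => returnBeforeProb_glauber_le hβ hN
      (fun σ => by rw [abs_sub_comm]; exact h σ) hD' hD hA hAB) hM

theorem GlauberMetastable.mono {ρ ρ' : ℝ} (h : ρ ≤ ρ') {K : ℕ} {M : Fin K → Set (Config N)}
    (hM : GlauberMetastable β H ρ M) : GlauberMetastable β H ρ' M :=
  ⟨hM.1, hM.2.1, hM.2.2.1, hM.2.2.2.trans (ENNReal.ofReal_le_ofReal h)⟩

theorem abs_spin (σ : Config N) (i : Fin N) : |spin σ i| = 1 := by
  rcases Int.units_eq_one_or (σ i) with h | h <;> simp [spin, h]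

theorem abs_hamiltonian_flip_sub_le {J : ℕ → ℕ → ℝ} {kJ : ℝ} (hkJ : 0 ≤ kJ)
    (hJ : ∀ i j, i < j → |J i j| ≤ kJ) (h : ℝ) {σ σ' : Config N} (hf : SingleFlip σ σ') :
    |hamiltonian h J N σ' - hamiltonian h J N σ| ≤ 4 * kJ + 2 * |h| := by
  classical
  obtain ⟨k, rfl⟩ := hf
  set σ' : Config N := Function.update σ k (-σ k)
  have hN : (0 : ℝ) < N := Nat.cast_pos.2 k.pos
  have hspin : ∀ i, i ≠ k → spin σ' i = spin σ i := fun i hi => by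
    simp [spin, σ', Function.update_of_ne hi]
  have hdiff : ∀ i, |spin σ' i - spin σ i| ≤ if i = k then 2 else 0 := fun i => by
    split_ifs with hi
    · refine (abs_sub _ _).trans ?_
      rw [abs_spin, abs_spin]; norm_num
    · rw [hspin i hi]; simp
  have hfield : |∑ i, spin σ' i - ∑ i, spin σ i| ≤ 2 := by
    rw [← Finset.sum_sub_distrib]
    refine (Finset.abs_sum_le_sum_abs _ _).trans ((Finset.sum_le_sum fun i _ => hdiff i).trans ?_)
    simp
  have hterm : ∀ i j : Fin N,
      |(if i < j then J i j * spin σ' i * spin σ' j else 0)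
        - (if i < j then J i j * spin σ i * spin σ j else 0)|
      ≤ kJ * ((if i = k then 2 else 0) + if j = k then 2 else 0) := by
    intro i j
    have hnn : 0 ≤ kJ * ((if i = k then 2 else 0) + if j = k then (2 : ℝ) else 0) :=
      mul_nonneg hkJ (add_nonneg (by split_ifs <;> norm_num) (by split_ifs <;> norm_num))
    by_cases hij : i < j
    · rw [if_pos hij, if_pos hij]
      have e : J i j * spin σ' i * spin σ' j - J i j * spin σ i * spin σ j
          = J i j * ((spin σ' i - spin σ i) * spin σ' j + spin σ i * (spin σ' j - spin σ j)) := by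
        ring
      rw [e, abs_mul]
      refine mul_le_mul (hJ i j hij) ((abs_add_le _ _).trans ?_) (abs_nonneg _) hkJ
      rw [abs_mul, abs_mul, abs_spin, abs_spin, mul_one, one_mul]
      exact add_le_add (hdiff i) (hdiff j)
    · rw [if_neg hij, if_neg hij, sub_zero, abs_zero]
      exact hnn
  have hsum : |(∑ i : Fin N, ∑ j : Fin N, if i < j then J i j * spin σ' i * spin σ' j else 0)
      - ∑ i : Fin N, ∑ j : Fin N, if i < j then J i j * spin σ i * spin σ j else 0|
      ≤ 4 * kJ * N := by
    rw [← Finset.sum_sub_distrib]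
    simp only [← Finset.sum_sub_distrib]
    calc _ ≤ ∑ i : Fin N, ∑ j : Fin N,
            kJ * ((if i = k then 2 else 0) + if j = k then (2 : ℝ) else 0) :=
          (Finset.abs_sum_le_sum_abs _ _).trans (Finset.sum_le_sum fun i _ =>
            (Finset.abs_sum_le_sum_abs _ _).trans (Finset.sum_le_sum fun j _ => hterm i j))
      _ = 4 * kJ * N := by
          simp only [← Finset.mul_sum, Finset.sum_add_distrib, Finset.sum_const, Finset.card_univ,
            Fintype.card_fin, nsmul_eq_mul, Finset.sum_ite_eq', Finset.mem_univ, if_true]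
          ring
  rw [hamiltonian, hamiltonian]
  set S' := ∑ i : Fin N, ∑ j : Fin N, if i < j then J i j * spin σ' i * spin σ' j else 0
  set S := ∑ i : Fin N, ∑ j : Fin N, if i < j then J i j * spin σ i * spin σ j else 0
  have e : -(1 / (N : ℝ)) * S' - h * ∑ i, spin σ' i - (-(1 / (N : ℝ)) * S - h * ∑ i, spin σ i)
      = -((S' - S) / N) - h * (∑ i, spin σ' i - ∑ i, spin σ i) := by ring
  rw [e]
  refine (abs_sub _ _).trans (add_le_add ?_ ?_)
  · rw [abs_neg, abs_div, abs_of_pos hN, div_le_iff₀ hN]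
    exact hsum
  · rw [abs_mul, mul_comm]
    exact mul_le_mul_of_nonneg_right hfield (abs_nonneg h)

end Glauber

/-! ### Concentration under conditional independence -/

section Concentration

/-- If `Z` multiplied by the indicator of `X ∈ B` has conditional mean zero for all `B`, then so has
`X * Z`: for `D` in the conditioning σ-algebra, the conditional mean of `Z` restricted to `D` given
`X` vanishes. -/
theorem condExp_mul_eq_zero_of_indicator {Ω : Type*} {𝒢 mΩ : MeasurableSpace Ω} (h𝒢 : 𝒢 ≤ mΩ)
    {P : Measure Ω} [IsProbabilityMeasure P] {X Z : Ω → ℝ} (hX : Measurable[mΩ] X) {k : ℝ}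
    (hXk : ∀ᵐ ω ∂P, |X ω| ≤ k) (hZ : Integrable Z P)
    (h : ∀ B : Set ℝ, MeasurableSet B → P[(X ⁻¹' B).indicator Z | 𝒢] =ᵐ[P] 0) :
    P[X * Z | 𝒢] =ᵐ[P] 0 := by
  have hXbd : ∀ Z' : Ω → ℝ, Integrable Z' P → Integrable (X * Z') P := fun Z' hZ' =>
    hZ'.bdd_mul hX.aestronglyMeasurable hXk
  refine (ae_eq_condExp_of_forall_setIntegral_eq h𝒢 (hXbd Z hZ) (fun _ _ _ => integrableOn_zero)
    (fun D hD _ => ?_) aestronglyMeasurable_zero).symm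
  simp only [integral_zero]
  have hD' : MeasurableSet[mΩ] D := h𝒢 D hD
  set Z' : Ω → ℝ := D.indicator Z with hZ'def
  have hZ' : Integrable Z' P := hZ.indicator hD'
  have hle : MeasurableSpace.comap X inferInstance ≤ mΩ := hX.comap_le
  -- The conditional mean of `Z'` given `X` vanishes.
  have hcond : P[Z' | MeasurableSpace.comap X inferInstance] =ᵐ[P] 0 := by
    refine (ae_eq_condExp_of_forall_setIntegral_eq hle hZ' (fun _ _ _ => integrableOn_zero)
      ?_ aestronglyMeasurable_zero).symm
    rintro _ ⟨B, hB, rfl⟩ -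
    have hBm : MeasurableSet[mΩ] (X ⁻¹' B) := hX hB
    have h1 : ∫ ω in D, (X ⁻¹' B).indicator Z ω ∂P = 0 := by
      rw [← setIntegral_condExp h𝒢 (hZ.indicator hBm) hD]
      rw [setIntegral_congr_ae (g := fun _ => (0 : ℝ)) hD' ((h B hB).mono fun ω hω _ => hω)]
      simp
    simp only [integral_zero]
    rw [← h1, setIntegral_indicator hBm, hZ'def, setIntegral_indicator hD', Set.inter_comm]
  have hXm : StronglyMeasurable[MeasurableSpace.comap X inferInstance] X :=
    (comap_measurable X).stronglyMeasurable
  have h2 := condExp_mul_of_stronglyMeasurable_left hXm (hXbd Z' hZ') hZ'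
  have h3 : ∫ ω, (X * Z') ω ∂P = 0 := by
    rw [← integral_condExp hle, integral_congr_ae (h2.trans (hcond.mono fun ω hω => ?_))]
    · exact integral_zero _ _
    · simp [hω]
  rw [← h3, ← integral_indicator hD']
  congr 1
  ext ω
  by_cases hω : ω ∈ D <;> simp [hZ'def, hω]

/-- If `W` is conditionally uncorrelated with every event of the form `X ∈ B`, it is conditionally
uncorrelated with `X`. -/
theorem condExp_one_add_mul_sub_mul {Ω : Type*} {𝒢 mΩ : MeasurableSpace Ω} (h𝒢 : 𝒢 ≤ mΩ)
    {P : Measure Ω} [IsProbabilityMeasure P] {X W : Ω → ℝ} (hX : Measurable[mΩ] X) {k : ℝ}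
    (hXk : ∀ᵐ ω ∂P, |X ω| ≤ k) (hW : Integrable W P)
    (h : ∀ B : Set ℝ, MeasurableSet B →
      P[(X ⁻¹' B).indicator W | 𝒢] =ᵐ[P] P⟦X ⁻¹' B | 𝒢⟧ * P[W | 𝒢]) (c : ℝ) :
    P[(fun ω => 1 + c * (X ω - (P[X | 𝒢]) ω)) * W | 𝒢] =ᵐ[P] P[W | 𝒢] := by
  have hbd : ∀ Y Z' : Ω → ℝ, AEStronglyMeasurable[mΩ] Y P → (∀ᵐ ω ∂P, |Y ω| ≤ k) →
      Integrable Z' P → Integrable (Y * Z') P := fun Y Z' hY hYk hZ' => hZ'.bdd_mul hY hYk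
  have hXint : Integrable X P := by
    simpa using hbd X 1 hX.aestronglyMeasurable hXk (integrable_const 1)
  have hmk : ∀ᵐ ω ∂P, |(P[X | 𝒢]) ω| ≤ k := ae_bdd_abs_condExp_of_ae_bdd_abs hXk
  have hm : StronglyMeasurable[𝒢] (P[X | 𝒢]) := stronglyMeasurable_condExp
  have hg : StronglyMeasurable[𝒢] (P[W | 𝒢]) := stronglyMeasurable_condExp
  have hgint : Integrable (P[W | 𝒢]) P := integrable_condExp
  have hXW := hbd X W hX.aestronglyMeasurable hXk hW
  have hXg := hbd X _ hX.aestronglyMeasurable hXk hgint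
  have hmW := hbd _ W (hm.mono h𝒢).aestronglyMeasurable hmk hW
  have h0 : P[X * (W - P[W | 𝒢]) | 𝒢] =ᵐ[P] 0 := by
    refine condExp_mul_eq_zero_of_indicator h𝒢 hX hXk (hW.sub hgint) fun B hB => ?_
    have hBm : MeasurableSet[mΩ] (X ⁻¹' B) := hX hB
    have e1 : (X ⁻¹' B).indicator (W - P[W | 𝒢])
        = (X ⁻¹' B).indicator W - ((X ⁻¹' B).indicator fun _ => (1 : ℝ)) * P[W | 𝒢] := by
      ext ω; by_cases hω : ω ∈ X ⁻¹' B <;> simp [hω]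
    have hint : Integrable (((X ⁻¹' B).indicator fun _ => (1 : ℝ)) * P[W | 𝒢]) P := by
      have : ((X ⁻¹' B).indicator fun _ => (1 : ℝ)) * P[W | 𝒢] = (X ⁻¹' B).indicator P[W | 𝒢] := by
        ext ω; by_cases hω : ω ∈ X ⁻¹' B <;> simp [hω]
      rw [this]; exact hgint.indicator hBm
    rw [e1]
    refine (condExp_sub (hW.indicator hBm) hint 𝒢).trans ?_
    have e2 := condExp_mul_of_stronglyMeasurable_right hg hint
      ((integrable_const (1 : ℝ)).indicator hBm)
    filter_upwards [h B hB, e2] with ω h1 h2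
    simp only [Pi.sub_apply, Pi.zero_apply, h1, h2]
    exact sub_self _
  have e3 : P[X * W | 𝒢] =ᵐ[P] P[X | 𝒢] * P[W | 𝒢] := by
    have e4 : X * W = X * (W - P[W | 𝒢]) + X * P[W | 𝒢] := by ring
    rw [e4]
    have hsub : Integrable (X * (W - P[W | 𝒢])) P := by rw [mul_sub]; exact hXW.sub hXg
    refine (condExp_add hsub hXg 𝒢).trans ?_
    filter_upwards [h0, condExp_mul_of_stronglyMeasurable_right hg hXg hXint] with ω h1 h2
    simp [h1, h2]
  have e5 : (fun ω => 1 + c * (X ω - (P[X | 𝒢]) ω)) * W = W + c • (X * W - P[X | 𝒢] * W) := by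
    ext ω; simp; ring
  rw [e5]
  refine (condExp_add hW ((hXW.sub hmW).smul c) 𝒢).trans ?_
  filter_upwards [condExp_smul c (X * W - P[X | 𝒢] * W) 𝒢 (μ := P), condExp_sub hXW hmW 𝒢, e3,
    condExp_mul_of_stronglyMeasurable_left hm hmW hW] with ω h1 h2 h3 h4
  simp [h1, h2, h3, h4]

variable {Ω : Type*} {𝒢 mΩ : MeasurableSpace Ω} {P : Measure Ω} [IsProbabilityMeasure P]
  {ι : Type*} {X : ι → Ω → ℝ} {k : ℝ}

theorem ae_abs_sub_condExp_le {Ω : Type*} {𝒢 mΩ : MeasurableSpace Ω} {P : Measure Ω} {k : ℝ}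
    {Y : Ω → ℝ} (hY : ∀ᵐ ω ∂P, |Y ω| ≤ k) :
    ∀ᵐ ω ∂P, |Y ω - (P[Y | 𝒢]) ω| ≤ 2 * k := by
  filter_upwards [hY, ae_bdd_abs_condExp_of_ae_bdd_abs (m := 𝒢) hY] with ω h1 h2
  have := abs_sub (Y ω) ((P[Y | 𝒢]) ω)
  linarith

theorem integrable_prod_one_add (h𝒢 : 𝒢 ≤ mΩ) (hX : ∀ i, Measurable[mΩ] (X i))
    (hXk : ∀ i, ∀ᵐ ω ∂P, |X i ω| ≤ k) (c : ι → ℝ) (t : Finset ι) :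
    Integrable (fun ω => ∏ i ∈ t, (1 + c i * (X i ω - (P[X i | 𝒢]) ω))) P := by
  classical
  induction t using Finset.induction_on with
  | empty => simp
  | insert j t hj ih =>
    simp only [Finset.prod_insert hj]
    refine ih.bdd_mul (c := 1 + |c j| * (2 * k)) ?_ ?_
    · exact (measurable_const.add (((hX j).sub
        (stronglyMeasurable_condExp.mono h𝒢).measurable).const_mul _)).aestronglyMeasurable
    · filter_upwards [ae_abs_sub_condExp_le (𝒢 := 𝒢) (hXk j)] with ω hω
      rw [Real.norm_eq_abs]
      refine (abs_add_le _ _).trans ?_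
      rw [abs_one, abs_mul]
      gcongr

/-- For conditionally independent variables, a product of factors with conditional mean one is
conditionally uncorrelated with the events that depend on the remaining variables. -/
theorem condExp_prod_one_add_mul_indicator (h𝒢 : 𝒢 ≤ mΩ) (hX : ∀ i, Measurable[mΩ] (X i))
    (hXk : ∀ i, ∀ᵐ ω ∂P, |X i ω| ≤ k) (hind : CondIndepFamily 𝒢 P X) (c : ι → ℝ)
    (t : Finset ι) : ∀ (u : Finset ι) (B : ι → Set ℝ), Disjoint t u →
      (∀ i ∈ u, MeasurableSet (B i)) →
      P[(⋂ i ∈ u, X i ⁻¹' B i).indicator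
          (fun ω => ∏ i ∈ t, (1 + c i * (X i ω - (P[X i | 𝒢]) ω))) | 𝒢]
        =ᵐ[P] ∏ i ∈ u, P⟦X i ⁻¹' B i | 𝒢⟧ := by
  classical
  induction t using Finset.induction_on with
  | empty =>
    intro u B _ hB
    simpa using hind u B hB
  | insert j t hj ih =>
    intro u B hdisj hB
    have hju : j ∉ u := Finset.disjoint_left.1 hdisj (Finset.mem_insert_self j t)
    have htu : Disjoint t u := Finset.disjoint_of_subset_left (Finset.subset_insert j t) hdisj
    have hUm : MeasurableSet[mΩ] (⋂ i ∈ u, X i ⁻¹' B i) :=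
      Finset.measurableSet_biInter u fun i hi => hX i (hB i hi)
    set W : Ω → ℝ := (⋂ i ∈ u, X i ⁻¹' B i).indicator
      (fun ω => ∏ i ∈ t, (1 + c i * (X i ω - (P[X i | 𝒢]) ω))) with hWdef
    have hW : Integrable W P := (integrable_prod_one_add h𝒢 hX hXk c t).indicator hUm
    have hkey := condExp_one_add_mul_sub_mul h𝒢 (hX j) (hXk j) hW (fun C hC => ?_) (c j)
    · have e : (⋂ i ∈ u, X i ⁻¹' B i).indicator
          (fun ω => ∏ i ∈ insert j t, (1 + c i * (X i ω - (P[X i | 𝒢]) ω)))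
          = (fun ω => 1 + c j * (X j ω - (P[X j | 𝒢]) ω)) * W := by
        ext ω
        by_cases hω : ω ∈ ⋂ i ∈ u, X i ⁻¹' B i
        · simp only [hWdef, Pi.mul_apply, Set.indicator_of_mem hω, Finset.prod_insert hj]
        · simp only [hWdef, Pi.mul_apply, Set.indicator_of_notMem hω, mul_zero]
      rw [e]
      exact hkey.trans (ih u B htu hB)
    · have hne : ∀ i ∈ u, i ≠ j := fun i hi hij => hju (hij ▸ hi)
      have h1 := ih (insert j u) (Function.update B j C)
        (Finset.disjoint_insert_right.2 ⟨hj, htu⟩) (fun i hi => by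
          rcases Finset.mem_insert.1 hi with rfl | hi
          · simpa using hC
          · rw [Function.update_of_ne (hne i hi)]; exact hB i hi)
      have h2 : (⋂ i ∈ insert j u, X i ⁻¹' (Function.update B j C) i)
          = X j ⁻¹' C ∩ ⋂ i ∈ u, X i ⁻¹' B i := by
        rw [Finset.set_biInter_insert, Function.update_self]
        congr 1
        exact Set.iInter₂_congr fun i hi => by rw [Function.update_of_ne (hne i hi)]
      rw [h2, Finset.prod_insert hju, Function.update_self, ← Set.indicator_indicator] at h1
      refine h1.trans ?_
      have h3 : ∏ i ∈ u, P⟦X i ⁻¹' (Function.update B j C) i | 𝒢⟧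
          = ∏ i ∈ u, P⟦X i ⁻¹' B i | 𝒢⟧ :=
        Finset.prod_congr rfl fun i hi => by rw [Function.update_of_ne (hne i hi)]
      rw [h3]
      exact EventuallyEq.rfl.mul (ih u B htu hB).symm

theorem integral_prod_one_add (h𝒢 : 𝒢 ≤ mΩ) (hX : ∀ i, Measurable[mΩ] (X i))
    (hXk : ∀ i, ∀ᵐ ω ∂P, |X i ω| ≤ k) (hind : CondIndepFamily 𝒢 P X) (c : ι → ℝ)
    (t : Finset ι) :
    ∫ ω, ∏ i ∈ t, (1 + c i * (X i ω - (P[X i | 𝒢]) ω)) ∂P = 1 := by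
  have h := condExp_prod_one_add_mul_indicator h𝒢 hX hXk hind c t ∅ (fun _ => ∅)
    (Finset.disjoint_empty_right t) (by simp)
  simp only [Finset.notMem_empty, Set.iInter_of_empty, Set.iInter_univ, Set.indicator_univ,
    Finset.prod_empty] at h
  rw [← integral_condExp h𝒢, integral_congr_ae h]
  simp

/-- On `[-a, a]` the exponential lies below its chord. -/
theorem exp_le_cosh_mul_one_add {a z : ℝ} (ha : 0 < a) (hz : |z| ≤ a) :
    Real.exp z ≤ Real.cosh a * (1 + Real.sinh a / (a * Real.cosh a) * z) := by
  have hz' := abs_le.1 hz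
  have h1 : 0 ≤ (a - z) / (2 * a) := div_nonneg (by linarith) (by linarith)
  have h2 : 0 ≤ (a + z) / (2 * a) := div_nonneg (by linarith) (by linarith)
  have h3 : (a - z) / (2 * a) + (a + z) / (2 * a) = 1 := by field_simp; ring
  have hconv := convexOn_exp.2 (Set.mem_univ (-a)) (Set.mem_univ a) h1 h2 h3
  have e : ((a - z) / (2 * a)) • (-a) + ((a + z) / (2 * a)) • a = z := by
    simp only [smul_eq_mul]; field_simp; ring
  rw [e] at hconv
  refine hconv.trans (le_of_eq ?_)
  have hc := Real.cosh_pos a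
  have e2 : Real.cosh a * (1 + Real.sinh a / (a * Real.cosh a) * z)
      = Real.cosh a + Real.sinh a * z / a := by field_simp
  rw [e2, Real.cosh_eq, Real.sinh_eq]
  simp only [smul_eq_mul]
  field_simp
  ring

/-- A conditional Hoeffding bound for the moment generating function. Each exponential is dominated
by its chord, which is affine in the centred variable, so that only products of centred variables
have to be averaged. -/
theorem lintegral_exp_sum_le (h𝒢 : 𝒢 ≤ mΩ) (hX : ∀ i, Measurable[mΩ] (X i)) (hk : 0 < k)
    (hXk : ∀ i, ∀ᵐ ω ∂P, |X i ω| ≤ k) (hind : CondIndepFamily 𝒢 P X) {s : ι → ℝ}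
    (hs : ∀ i, |s i| ≤ 1) {l : ℝ} (hl : 0 < l) (t : Finset ι) :
    ∫⁻ ω, ENNReal.ofReal (Real.exp (l * ∑ i ∈ t, s i * (X i ω - (P[X i | 𝒢]) ω))) ∂P
      ≤ ENNReal.ofReal (Real.exp (2 * (k * l) ^ 2 * t.card)) := by
  set a : ℝ := 2 * k * l with ha
  have ha0 : 0 < a := by positivity
  set c : ι → ℝ := fun i => Real.sinh a / (a * Real.cosh a) * (l * s i) with hc
  have hae : ∀ᵐ ω ∂P, ∀ i ∈ t, |X i ω - (P[X i | 𝒢]) ω| ≤ 2 * k :=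
    (ae_ball_iff t.countable_toSet).2 fun i _ => ae_abs_sub_condExp_le (hXk i)
  have hpt : ∀ᵐ ω ∂P, Real.exp (l * ∑ i ∈ t, s i * (X i ω - (P[X i | 𝒢]) ω))
      ≤ Real.cosh a ^ t.card * ∏ i ∈ t, (1 + c i * (X i ω - (P[X i | 𝒢]) ω)) := by
    filter_upwards [hae] with ω hω
    rw [Finset.mul_sum, Real.exp_sum, ← Finset.prod_const, ← Finset.prod_mul_distrib]
    refine Finset.prod_le_prod (fun _ _ => (Real.exp_pos _).le) fun i hi => ?_
    have := exp_le_cosh_mul_one_add ha0 (z := l * (s i * (X i ω - (P[X i | 𝒢]) ω))) (by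
      rw [abs_mul, abs_mul, abs_of_pos hl, ha]
      calc l * (|s i| * |X i ω - (P[X i | 𝒢]) ω|) ≤ l * (1 * (2 * k)) := by
            gcongr
            · exact hs i
            · exact hω i hi
        _ = 2 * k * l := by ring)
    refine this.trans (le_of_eq ?_)
    rw [hc]; ring
  have hint := (integrable_prod_one_add h𝒢 hX hXk c t).const_mul (Real.cosh a ^ t.card)
  have hnn : 0 ≤ᵐ[P] fun ω => Real.cosh a ^ t.card *
      ∏ i ∈ t, (1 + c i * (X i ω - (P[X i | 𝒢]) ω)) :=
    hpt.mono fun ω hω => (Real.exp_pos _).le.trans hω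
  calc _ ≤ ∫⁻ ω, ENNReal.ofReal (Real.cosh a ^ t.card *
          ∏ i ∈ t, (1 + c i * (X i ω - (P[X i | 𝒢]) ω))) ∂P :=
        lintegral_mono_ae (hpt.mono fun ω hω => ENNReal.ofReal_le_ofReal hω)
    _ = ENNReal.ofReal (Real.cosh a ^ t.card) := by
        rw [← ofReal_integral_eq_lintegral_ofReal hint hnn, integral_const_mul,
          integral_prod_one_add h𝒢 hX hXk hind, mul_one]
    _ ≤ _ := by
        refine ENNReal.ofReal_le_ofReal ?_
        calc Real.cosh a ^ t.card ≤ Real.exp (a ^ 2 / 2) ^ t.card :=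
              pow_le_pow_left₀ (Real.cosh_pos a).le (Real.cosh_le_exp_half_sq a) _
          _ = _ := by rw [← Real.exp_nat_mul, ha]; congr 1; ring

/-- The Chernoff bound with free parameter `l`. -/
theorem measure_sum_ge_le (h𝒢 : 𝒢 ≤ mΩ) (hX : ∀ i, Measurable[mΩ] (X i)) (hk : 0 < k)
    (hXk : ∀ i, ∀ᵐ ω ∂P, |X i ω| ≤ k) (hind : CondIndepFamily 𝒢 P X) {s : ι → ℝ}
    (hs : ∀ i, |s i| ≤ 1) {l : ℝ} (hl : 0 < l) (t : Finset ι) (b : ℝ) :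
    P {ω | b ≤ ∑ i ∈ t, s i * (X i ω - (P[X i | 𝒢]) ω)}
      ≤ ENNReal.ofReal (Real.exp (2 * (k * l) ^ 2 * t.card - l * b)) := by
  set S : Ω → ℝ := fun ω => ∑ i ∈ t, s i * (X i ω - (P[X i | 𝒢]) ω) with hS
  have hSm : Measurable[mΩ] S := Finset.measurable_sum t fun i _ =>
    ((hX i).sub (stronglyMeasurable_condExp.mono h𝒢).measurable).const_mul _
  have hsub : {ω | b ≤ S ω}
      ⊆ {ω | ENNReal.ofReal (Real.exp (l * b)) ≤ ENNReal.ofReal (Real.exp (l * S ω))} := by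
    intro ω hω
    exact ENNReal.ofReal_le_ofReal (Real.exp_le_exp.2 (mul_le_mul_of_nonneg_left hω hl.le))
  have hm : Measurable[mΩ] fun ω => ENNReal.ofReal (Real.exp (l * S ω)) :=
    (Real.measurable_exp.comp (hSm.const_mul l)).ennreal_ofReal
  refine (measure_mono hsub).trans ((meas_ge_le_lintegral_div hm.aemeasurable
    (by simpa using Real.exp_pos _) ENNReal.ofReal_ne_top).trans ?_)
  rw [Real.exp_sub, ENNReal.ofReal_div_of_pos (Real.exp_pos _)]
  gcongr
  exact lintegral_exp_sum_le h𝒢 hX hk hXk hind hs hl t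

end Concentration

/-! ### The random Hamiltonian -/

section RandomHamiltonian

/-- The pairs `i < j` of sites of the system of size `N`. -/
def pairs (N : ℕ) : Finset {e : ℕ × ℕ // e.1 < e.2} :=
  (Finset.range N ×ˢ Finset.range N).subtype fun e => e.1 < e.2

theorem card_pairs_le (N : ℕ) : (pairs N).card ≤ N ^ 2 := by
  rw [pairs, Finset.card_subtype]
  refine (Finset.card_filter_le _ _).trans ?_
  rw [Finset.card_product, Finset.card_range, sq]

/-- The product `σ i * σ j` for the pair `(i, j)`, extended by `0` to indices out of range. -/
def spinPair {N : ℕ} (σ : Config N) (e : ℕ × ℕ) : ℝ :=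
  if he : e.1 < N ∧ e.2 < N then spin σ ⟨e.1, he.1⟩ * spin σ ⟨e.2, he.2⟩ else 0

theorem abs_spinPair_le {N : ℕ} (σ : Config N) (e : ℕ × ℕ) : |spinPair σ e| ≤ 1 := by
  rw [spinPair]
  split_ifs
  · rw [abs_mul, abs_spin, abs_spin, mul_one]
  · simp

theorem sum_pairs_spinPair {N : ℕ} (J : ℕ → ℕ → ℝ) (σ : Config N) :
    ∑ e ∈ pairs N, spinPair σ e.1 * J e.1.1 e.1.2
      = ∑ i : Fin N, ∑ j : Fin N, if i < j then J i j * spin σ i * spin σ j else 0 := by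
  rw [pairs, Finset.sum_subtype_eq_sum_filter (f := fun e => spinPair σ e * J e.1 e.2),
    Finset.sum_filter, Finset.sum_product, Finset.sum_range]
  refine Finset.sum_congr rfl fun i _ => ?_
  rw [Finset.sum_range]
  refine Finset.sum_congr rfl fun j _ => ?_
  simp only [Fin.val_fin_lt]
  split_ifs
  · rw [spinPair, dif_pos ⟨i.2, j.2⟩]; ring
  · rfl

theorem hamiltonian_sub {N : ℕ} (h : ℝ) (J J' : ℕ → ℕ → ℝ) (σ : Config N) :
    hamiltonian h J N σ - hamiltonian h J' N σ
      = -(1 / N * ∑ e ∈ pairs N, spinPair σ e.1 * (J e.1.1 e.1.2 - J' e.1.1 e.1.2)) := by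
  simp only [mul_sub, Finset.sum_sub_distrib]
  rw [sum_pairs_spinPair, sum_pairs_spinPair, hamiltonian, hamiltonian]
  ring

theorem summable_two_pow_mul_exp_neg_sq {g : ℝ} (hg : 0 < g) :
    Summable fun N : ℕ => (2 : ℝ) ^ N * 2 * Real.exp (-g * (N : ℝ) ^ 2) := by
  refine Summable.of_norm_bounded_eventually_nat (Real.summable_exp_neg_nat.mul_left 2) ?_
  filter_upwards [eventually_ge_atTop ⌈2 / g⌉₊] with N hN
  have hN' : 2 / g ≤ N := (Nat.le_ceil _).trans (by exact_mod_cast hN)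
  rw [div_le_iff₀ hg] at hN'
  rw [Real.norm_of_nonneg (by positivity)]
  have h2 : (2 : ℝ) ^ N ≤ Real.exp N := by
    rw [← mul_one (N : ℝ), Real.exp_nat_mul]
    exact pow_le_pow_left₀ zero_le_two (by linarith [Real.add_one_le_exp 1]) _
  calc (2 : ℝ) ^ N * 2 * Real.exp (-g * (N : ℝ) ^ 2)
      ≤ Real.exp N * 2 * Real.exp (-(2 * N)) := by
        gcongr
        nlinarith [Nat.cast_nonneg (α := ℝ) N]
    _ = 2 * Real.exp (-(N : ℝ)) := by
        rw [mul_comm (Real.exp _) 2, mul_assoc, ← Real.exp_add]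
        congr 2; ring

/-- Almost surely, the quenched and the annealed Hamiltonian differ by `o(N)`, uniformly over the
`2 ^ N` configurations: each difference exceeds `ε * N` with probability at most `exp (-g * N ^ 2)`
only. -/
theorem ae_eventually_abs_quenched_sub_annealed_le {Ω : Type*} {𝒢 mΩ : MeasurableSpace Ω}
    (h𝒢 : 𝒢 ≤ mΩ) {P : Measure Ω} [IsProbabilityMeasure P] {J : ℕ → ℕ → Ω → ℝ}
    (hJ_meas : ∀ i j, i < j → Measurable[mΩ] (J i j)) {kJ : ℝ} (hkJ : 0 < kJ)
    (hJ_bdd : ∀ i j, i < j → ∀ᵐ ω ∂P, |J i j ω| ≤ kJ)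
    (hJ_indep : CondIndepFamily 𝒢 P
      (fun (e : {e : ℕ × ℕ // e.1 < e.2}) => J e.1.1 e.1.2)) (h : ℝ) {ε : ℝ} (hε : 0 < ε) :
    ∀ᵐ ω ∂P, ∀ᶠ N : ℕ in atTop, ∀ σ : Config N,
      |quenchedHamiltonian h J N ω σ - annealedHamiltonian 𝒢 P h J N ω σ| ≤ ε * N := by
  set X : {e : ℕ × ℕ // e.1 < e.2} → Ω → ℝ := fun e => J e.1.1 e.1.2 with hXdef
  set bad : ℕ → Set Ω := fun N => ⋃ q : Config N × ℤˣ,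
    {ω | ε * (N : ℝ) ^ 2 ≤
      ∑ e ∈ pairs N, (((q.2 : ℤ) : ℝ) * spinPair q.1 e.1) * (X e ω - (P[X e | 𝒢]) ω)} with hbad
  set g : ℝ := ε ^ 2 / (8 * kJ ^ 2) with hg
  have hg0 : 0 < g := by positivity
  have hsign : ∀ u : ℤˣ, |((u : ℤ) : ℝ)| = 1 := fun u => by
    rcases Int.units_eq_one_or u with h | h <;> simp [h]
  have hbound : ∀ N, P (bad N)
      ≤ ENNReal.ofReal ((2 : ℝ) ^ N * 2 * Real.exp (-g * (N : ℝ) ^ 2)) := by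
    intro N
    have hone : ∀ q : Config N × ℤˣ, P {ω | ε * (N : ℝ) ^ 2 ≤
        ∑ e ∈ pairs N, (((q.2 : ℤ) : ℝ) * spinPair q.1 e.1) * (X e ω - (P[X e | 𝒢]) ω)}
        ≤ ENNReal.ofReal (Real.exp (-g * (N : ℝ) ^ 2)) := by
      intro q
      -- The choice of `l` minimizes the exponent in the Chernoff bound.
      refine (measure_sum_ge_le h𝒢 (fun e => hJ_meas _ _ e.2) hkJ (fun e => hJ_bdd _ _ e.2)
        hJ_indep (s := fun e => ((q.2 : ℤ) : ℝ) * spinPair q.1 e.1) (fun e => ?_)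
        (l := ε / (4 * kJ ^ 2)) (by positivity) (pairs N) _).trans ?_
      · rw [abs_mul, hsign, one_mul]; exact abs_spinPair_le _ _
      · refine ENNReal.ofReal_le_ofReal (Real.exp_le_exp.2 ?_)
        have hcard : ((pairs N).card : ℝ) ≤ (N : ℝ) ^ 2 := by exact_mod_cast card_pairs_le N
        calc 2 * (kJ * (ε / (4 * kJ ^ 2))) ^ 2 * ((pairs N).card : ℝ)
              - ε / (4 * kJ ^ 2) * (ε * (N : ℝ) ^ 2)
            ≤ 2 * (kJ * (ε / (4 * kJ ^ 2))) ^ 2 * (N : ℝ) ^ 2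
              - ε / (4 * kJ ^ 2) * (ε * (N : ℝ) ^ 2) := by gcongr
          _ = -g * (N : ℝ) ^ 2 := by rw [hg]; field_simp; ring
    calc P (bad N) ≤ ∑ q : Config N × ℤˣ, ENNReal.ofReal (Real.exp (-g * (N : ℝ) ^ 2)) :=
          (measure_iUnion_fintype_le P _).trans (Finset.sum_le_sum fun q _ => hone q)
      _ = _ := by
          rw [Finset.sum_const, Finset.card_univ, nsmul_eq_mul,
            ENNReal.ofReal_mul (by positivity), ENNReal.ofReal_mul (by positivity),
            ENNReal.ofReal_pow zero_le_two]
          simp [Fintype.card_prod]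
  have hsum : ∑' N, P (bad N) ≠ ∞ := by
    refine ne_top_of_le_ne_top ?_ (ENNReal.tsum_le_tsum hbound)
    rw [← ENNReal.ofReal_tsum_of_nonneg (fun N => by positivity)
      (summable_two_pow_mul_exp_neg_sq hg0)]
    exact ENNReal.ofReal_ne_top
  filter_upwards [ae_eventually_notMem hsum] with ω hω
  filter_upwards [hω, eventually_gt_atTop 0] with N hN hN0 σ
  have hN' : (0 : ℝ) < N := Nat.cast_pos.2 hN0
  have hnot : ∀ u : ℤˣ, ((u : ℤ) : ℝ) *
      ∑ e ∈ pairs N, spinPair σ e.1 * (X e ω - (P[X e | 𝒢]) ω) < ε * (N : ℝ) ^ 2 := by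
    intro u
    by_contra hu
    refine hN (Set.mem_iUnion.2 ⟨(σ, u), ?_⟩)
    simp only [Set.mem_ofPred_eq, mul_assoc]
    rw [← Finset.mul_sum]
    exact not_lt.1 hu
  rw [quenchedHamiltonian, annealedHamiltonian, hamiltonian_sub, abs_neg, abs_mul,
    abs_of_pos (one_div_pos.2 hN'), one_div, inv_mul_le_iff₀ hN', abs_le]
  have h1 := hnot 1
  have h2 := hnot (-1)
  simp only [Units.val_one, Int.cast_one, one_mul, Units.val_neg, Int.cast_neg, neg_mul] at h1 h2
  constructor <;> nlinarith

end RandomHamiltonian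

end GlauberMeta

end

theorem mainTheorem1
    {Ω : Type*} (𝒢 : MeasurableSpace Ω) {mΩ : MeasurableSpace Ω} (h𝒢 : 𝒢 ≤ mΩ)
    (P : Measure Ω) [IsProbabilityMeasure P]
    (J : ℕ → ℕ → Ω → ℝ)
    (hJ_meas : ∀ i j, i < j → Measurable[mΩ] (J i j))
    (kJ : ℝ) (hkJ : 0 < kJ)
    (hJ_bdd : ∀ i j, i < j → ∀ᵐ ω ∂P, |J i j ω| ≤ kJ)
    (hJ_indep : GlauberMeta.CondIndepFamily 𝒢 P
      (fun (e : {e : ℕ × ℕ // e.1 < e.2}) => J e.1.1 e.1.2))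
    (β : ℝ) (hβ : 0 < β) (h : ℝ)
    (K : ℕ) (hK : 2 ≤ K) (k₁ : ℝ) (hk₁ : 0 < k₁)
    (M : (N : ℕ) → Ω → Fin K → Set (GlauberMeta.Config N))
    (hM : ∀ᵐ ω ∂P, ∀ᶠ N : ℕ in atTop,
      GlauberMeta.GlauberMetastable β (GlauberMeta.annealedHamiltonian 𝒢 P h J N ω)
        (Real.exp (-k₁ * N)) (M N ω))
    (c₀ : ℝ) (hc₀ : 0 < c₀) (hc₀k₁ : c₀ < k₁) :
    ∀ᵐ ω ∂P, ∀ᶠ N : ℕ in atTop,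
      GlauberMeta.GlauberMetastable β (GlauberMeta.annealedHamiltonian 𝒢 P h J N ω)
        (Real.exp (-k₁ * N)) (M N ω) ∧
      GlauberMeta.GlauberMetastable β (GlauberMeta.quenchedHamiltonian h J N ω)
        (Real.exp (-c₀ * N)) (M N ω) := by
  set ε : ℝ := (k₁ - c₀) / (16 * β) with hε
  have hε0 : 0 < ε := div_pos (by linarith) (by positivity)
  set D : ℝ := 4 * kJ + 2 * |h| with hD
  have hbdd : ∀ᵐ ω ∂P, ∀ i j, i < j → |J i j ω| ≤ kJ ∧ |(P[J i j | 𝒢]) ω| ≤ kJ := by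
    simp only [ae_all_iff]
    exact fun i j hij => (hJ_bdd i j hij).and (ae_bdd_abs_condExp_of_ae_bdd_abs (hJ_bdd i j hij))
  -- Half of the gap `k₁ - c₀` absorbs the random perturbation, the other half the factors of
  -- subexponential size that come from the exit rates.
  have hsub : ∀ᶠ N : ℕ in atTop,
      (N : ℝ) ^ 2 ≤ Real.exp (-(2 * β * D)) * Real.exp ((k₁ - c₀) / 2 * N) := by
    have := ((isLittleO_pow_exp_pos_mul_atTop 2 (b := (k₁ - c₀) / 2) (by linarith)).comp_tendsto
      tendsto_natCast_atTop_atTop).def (Real.exp_pos (-(2 * β * D)))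
    filter_upwards [this] with N hN
    simpa using hN
  filter_upwards [hM, hbdd, GlauberMeta.ae_eventually_abs_quenched_sub_annealed_le h𝒢 hJ_meas hkJ
    hJ_bdd hJ_indep h hε0] with ω hMω hbω hHω
  filter_upwards [hMω, hHω, hsub, eventually_gt_atTop 0] with N hMN hHN hsubN hN0
  refine ⟨hMN, GlauberMeta.GlauberMetastable.mono ?_ (GlauberMeta.GlauberMetastable.of_abs_sub_le
    hβ.le hN0 hHN
    (fun σ σ' hf => GlauberMeta.abs_hamiltonian_flip_sub_le hkJ.le (fun i j hij => (hbω i j hij).1)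
      h hf)
    (fun σ σ' hf => GlauberMeta.abs_hamiltonian_flip_sub_le hkJ.le (fun i j hij => (hbω i j hij).2)
      h hf) hMN)⟩
  calc (N * Real.exp (4 * β * (ε * N) + β * D)) ^ 2 * Real.exp (-k₁ * N)
      = (N : ℝ) ^ 2 * Real.exp ((k₁ - c₀) / 2 * N + 2 * β * D - k₁ * N) := by
        rw [mul_pow, ← Real.exp_nat_mul, mul_assoc, ← Real.exp_add, hε]
        congr 2
        field_simp
        push_cast
        ring
    _ ≤ Real.exp (-(2 * β * D)) * Real.exp ((k₁ - c₀) / 2 * N)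
          * Real.exp ((k₁ - c₀) / 2 * N + 2 * β * D - k₁ * N) :=
        mul_le_mul_of_nonneg_right hsubN (Real.exp_pos _).le
    _ = Real.exp (-c₀ * N) := by
        rw [← Real.exp_add, ← Real.exp_add]
        congr 1; ring
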